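/- **Theorem 4.1.** Let $k$ be a commutative ring and let $H$ be a Hopf algebra over $k$ with bijective antipode $S$, projective as a $k$-module. Let $A$ be a right $H$-comodule algebra with coaction $\rho(a)=a_{[0]}\otimes a_{[1]}$, and let $B=A^{\mathrm{co}H}=\{a\in A : \rho(a)=a\otimes 1\}$. Assume that $A$ is a left faithfully flat $H$-Galois extension of $B$: the canonical map $A\otimes_B A\to A\otimes H$, $a\otimes_B a'\mapsto aa'_{[0]}\otimes a'_{[1]}$, is bijective, and $A$ is faithfully flat as a right $B$-module, that is, the functor $A\otimes_B-$ on left $B$-modules preserves and reflects exact sequences. For a left $B$-module $M$, the left $A$-module $P=A\otimes_B M$ is a right $H$-comodule with coaction $a\otimes_B m\mapsto (a_{[0]}\otimes_B m)\otimes a_{[1]}$. Let ${}_A\mathrm{END}(P)$ be the set of left $A$-linear maps $f:P\to P$ that are rational, that is, for which there is a (then unique) $f_{[0]}\otimes f_{[1]}\in{}_A\mathrm{End}(P)\otimes H$ with $\rho(f(p))=f_{[0]}(p_{[0]})\otimes p_{[1]}f_{[1]}$ for all $p\in P$. Then $f\mapsto f_{[0]}\otimes f_{[1]}$ makes $E={}_A\mathrm{END}(A\otimes_B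 M)^{\mathrm{op}}$ a right $H$-comodule algebra. Let $\mathcal C_E$ be the $k$-linear category with two objects $\mathbf 1,\mathbf 2$, whose morphisms are the following $k$-linear maps $H\to E$, the conditions being required for all $h\in H$: $$\mathcal C_E(\mathbf 1,\mathbf 1)=\{v : \rho(v(h))=v(h)\otimes 1\},\qquad \mathcal C_E(\mathbf 2,\mathbf 1)=\{t : \rho(t(h))=t(h_{(1)})\otimes h_{(2)}\},$$ $$\mathcal C_E(\mathbf 1,\mathbf 2)=\{u : \rho(u(h))=u(h_{(2)})\otimes S(h_{(1)})\},\qquad \mathcal C_E(\mathbf 2,\mathbf 2)=\{w : \rho(w(h))=w(h_{(2)})\otimes S(h_{(1)})h_{(3)}\},$$ the composite of $f:\mathbf i\to\mathbf j$ and $g:\mathbf j\to\mathbf l$ being the convolution product $(g*f)(h)=g(h_{(1)})f(h_{(2)})$. Let ${}_B\mathcal M^H$ be the $k$-linear category of left $B$-modules $N$ with a right $H$-coaction such that $\rho(bn)=bn_{[0]}\otimes n_{[1]}$, with the left $B$-linear right $H$-colinear maps as morphisms. Let $\mathcal E_M$ be its full subcategory on the two objects $M\otimes H$ (with $b(m\otimes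 h)=bm\otimes h$ and $\rho(m\otimes h)=m\otimes h_{(1)}\otimes h_{(2)}$) and $A\otimes_B M$; the two objects are regarded as distinct. Then there is a $k$-linear duality $\alpha:\mathcal C_E\to\mathcal E_M$, i.e. a contravariant isomorphism of $k$-linear categories, with $\alpha(\mathbf 1)=M\otimes H$ and $\alpha(\mathbf 2)=A\otimes_B M$. -/

import Mathlib

open scoped TensorProduct

universe v u

noncomputable section

set_option linter.unusedSectionVars false

namespace HopfGalois

/-- A right `H`-comodule: a `k`-module `V` with a coassociative and counital coaction
`ρ : V → V ⊗ H`, `ρ(x) = x₀ ⊗ x₁`. -/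
class RightComodule (k : Type v) (H V : Type u) [CommRing k] [AddCommGroup H] [Module k H]
    [Coalgebra k H] [AddCommGroup V] [Module k V] where
  coact (k) (H) : V →ₗ[k] V ⊗[k] H
  coassoc : (TensorProduct.assoc k V H H).toLinearMap ∘ₗ coact.rTensor H ∘ₗ coact =
    (Coalgebra.comul (R := k) (A := H)).lTensor V ∘ₗ coact
  lTensor_counit : ∀ x : V, (Coalgebra.counit (R := k) (A := H)).lTensor V (coact x) = x ⊗ₜ 1

open RightComodule (coact)

/-- A right `H`-comodule algebra: an algebra with a right coaction that is unital and
multiplicative. -/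
class RightComoduleAlgebra (k : Type v) (H A : Type u) [CommRing k] [Ring H] [Bialgebra k H]
    [Ring A] [Algebra k A] extends RightComodule k H A where
  coact_one : toRightComodule.coact (1 : A) = 1
  coact_mul : ∀ a b : A,
    toRightComodule.coact (a * b) = toRightComodule.coact a * toRightComodule.coact b

/-- The antipode of `H` is bijective. -/
class BijectiveAntipode (k : Type v) (H : Type u) [CommRing k] [Ring H] [HopfAlgebra k H] :
    Prop where
  bijective : Function.Bijective (HopfAlgebra.antipode k (A := H))

section Coinvariants

variable (k : Type v) (H A : Type u) [CommRing k] [Ring H] [Bialgebra k H] [Ring A] [Algebra k A]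
  [RightComoduleAlgebra k H A]

/-- The coaction of a comodule algebra as an algebra map `A → A ⊗ H`. -/
def coactAlgHom : A →ₐ[k] A ⊗[k] H :=
  AlgHom.ofLinearMap (coact k H) RightComoduleAlgebra.coact_one RightComoduleAlgebra.coact_mul

/-- The subalgebra `A^{co H} = {a | ρ(a) = a ⊗ 1}` of coinvariants. -/
def coinvariants : Subalgebra k A :=
  AlgHom.equalizer (coactAlgHom k H A) (Algebra.TensorProduct.includeLeft : A →ₐ[k] A ⊗[k] H)

theorem mem_coinvariants (a : A) : a ∈ coinvariants k H A ↔ coact k H a = a ⊗ₜ[k] (1 : H) :=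
  Iff.rfl

end Coinvariants

section RelTensor

variable {k : Type v} {A : Type u} [CommRing k] [Ring A] [Algebra k A] (B : Subalgebra k A)
variable (M N P : Type u) [AddCommGroup M] [Module k M] [Module B M] [IsScalarTower k B M]
  [AddCommGroup N] [Module k N] [Module B N] [IsScalarTower k B N]

/-- The relations `ab ⊗ m = a ⊗ bm` defining `A ⊗_B M` as a quotient of `A ⊗_k M`. -/
def balanced : Submodule A (A ⊗[k] M) :=
  Submodule.span A {x | ∃ (a : A) (b : B) (m : M), x = (a * b) ⊗ₜ[k] m - a ⊗ₜ[k] (b • m)}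

/-- The tensor product `A ⊗_B M` over the (noncommutative) subalgebra `B` of `A`, for a left
`B`-module `M`, with its left `A`-module structure. -/
def RelTensor : Type u := (A ⊗[k] M) ⧸ balanced B M

instance : AddCommGroup (RelTensor B M) := inferInstanceAs (AddCommGroup (_ ⧸ balanced B M))
instance : Module A (RelTensor B M) := inferInstanceAs (Module A (_ ⧸ balanced B M))
instance : Module k (RelTensor B M) := inferInstanceAs (Module k (_ ⧸ balanced B M))
instance : IsScalarTower k A (RelTensor B M) :=
  inferInstanceAs (IsScalarTower k A (_ ⧸ balanced B M))
instance : IsScalarTower k B (RelTensor B M) where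
  smul_assoc c b x := by
    change ((c • b : B) : A) • x = c • ((b : A) • x)
    rw [← smul_assoc]; rfl

namespace RelTensor

variable {M N}

variable (M) in
/-- The canonical surjection `A ⊗_k M → A ⊗_B M`. -/
def proj : A ⊗[k] M →ₗ[A] RelTensor B M := Submodule.mkQ (balanced B M)

theorem proj_surjective : Function.Surjective (proj B M) := Submodule.Quotient.mk_surjective _

/-- The class `a ⊗_B m`. -/
def tmul (a : A) (m : M) : RelTensor B M := proj B M (a ⊗ₜ[k] m)

theorem smul_tmul (a a' : A) (m : M) : a • tmul B a' m = tmul B (a * a') m := rfl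

theorem tmul_smul (a : A) (b : B) (m : M) : tmul B a (b • m) = tmul B (a * b) m :=
  ((Submodule.Quotient.eq (balanced B M)).2 (Submodule.subset_span ⟨a, b, m, rfl⟩)).symm

theorem induction_on {motive : RelTensor B M → Prop} (x : RelTensor B M)
    (tmul : ∀ a m, motive (tmul B a m)) (add : ∀ x y, motive x → motive y → motive (x + y)) :
    motive x := by
  obtain ⟨x, rfl⟩ := proj_surjective B x
  induction x with
  | zero => simpa [RelTensor.tmul] using tmul 0 0
  | tmul a m => exact tmul a m
  | add x y hx hy => exact add _ _ hx hy

/-- The map `A ⊗_B f : A ⊗_B M → A ⊗_B N` induced by a left `B`-linear map `f`. -/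
def map (f : M →ₗ[B] N) : RelTensor B M →ₗ[A] RelTensor B N :=
  Submodule.mapQ (balanced B M) (balanced B N)
    (TensorProduct.AlgebraTensorModule.map (LinearMap.id : A →ₗ[A] A) (f.restrictScalars k)) <| by
      rw [balanced, Submodule.span_le]
      rintro _ ⟨a, b, m, rfl⟩
      refine Submodule.subset_span ⟨a, b, f m, ?_⟩
      simp

theorem map_tmul (f : M →ₗ[B] N) (a : A) (m : M) : map B f (tmul B a m) = tmul B a (f m) := rfl

end RelTensor

/-- `A` is faithfully flat as a right `B`-module: the functor `A ⊗_B -` on left `B`-modules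
preserves and reflects exact sequences. -/
def IsRightFaithfullyFlat : Prop :=
  ∀ (N₁ N₂ N₃ : Type u) [AddCommGroup N₁] [AddCommGroup N₂] [AddCommGroup N₃]
    [Module k N₁] [Module k N₂] [Module k N₃] [Module B N₁] [Module B N₂] [Module B N₃]
    [IsScalarTower k B N₁] [IsScalarTower k B N₂] [IsScalarTower k B N₃]
    (f : N₁ →ₗ[B] N₂) (g : N₂ →ₗ[B] N₃),
    Function.Exact (RelTensor.map B f) (RelTensor.map B g) ↔ Function.Exact f g

end RelTensor

section Galois

variable (k : Type v) (H A : Type u) [CommRing k] [Ring H] [Bialgebra k H] [Ring A] [Algebra k A]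
  [RightComoduleAlgebra k H A]

/-- The canonical map `can : A ⊗_B A → A ⊗ H`, `can(a ⊗_B a') = a a'₀ ⊗ a'₁`, where `B` is the
subalgebra of coinvariants. -/
def can : RelTensor (coinvariants k H A) A →ₗ[A] A ⊗[k] H :=
  Submodule.liftQ _ (TensorProduct.AlgebraTensorModule.lift
    (LinearMap.toSpanSingleton A (A →ₗ[k] A ⊗[k] H) (coact k H))) <| by
    rw [balanced, Submodule.span_le]
    rintro _ ⟨a, b, m, rfl⟩
    have hb : coact k H (b : A) = (b : A) ⊗ₜ[k] (1 : H) := b.2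
    have h1 : ∀ (c : A) (x : A ⊗[k] H), c • x = (c ⊗ₜ[k] (1 : H)) * x := fun c x => by
      induction x with
      | zero => simp
      | tmul p q => simp [TensorProduct.smul_tmul']
      | add x y hx hy => simp [smul_add, mul_add, hx, hy]
    have h2 : coact k H (b • m) = (b : A) • coact k H m := by
      change coact k H ((b : A) * m) = _
      rw [RightComoduleAlgebra.coact_mul, hb, h1]
    simp [h2, mul_smul]

theorem can_tmul (a a' : A) :
    can k H A (RelTensor.tmul _ a a') = (a ⊗ₜ[k] (1 : H)) * coact k H a' := by
  change a • (coact k H a' : A ⊗[k] H) = _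
  generalize (coact k H a' : A ⊗[k] H) = x
  induction x with
  | zero => simp
  | tmul p q => simp [TensorProduct.smul_tmul']
  | add x y hx hy => simp [smul_add, mul_add, hx, hy]

/-- `A` is an `H`-Galois extension of its subalgebra of coinvariants. -/
def IsHopfGalois : Prop := Function.Bijective (can k H A)

end Galois

section HopfModules

variable {k : Type v} {H A P Q : Type u} [CommRing k] [Ring H] [HopfAlgebra k H] [Ring A]
  [Algebra k A] [AddCommGroup P] [Module k P] [Module A P] [IsScalarTower k A P]
  [AddCommGroup Q] [Module k Q]

variable (k H A P) in
/-- The map `(A ⊗ H) ⊗ (P ⊗ H) → P ⊗ H`, `(a ⊗ h) (p ⊗ g) = ap ⊗ hg`. -/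
def diagAct : A ⊗[k] H →ₗ[k] P ⊗[k] H →ₗ[k] P ⊗[k] H :=
  TensorProduct.map₂ (Algebra.lsmul k k P : A →ₐ[k] Module.End k P).toLinearMap
    (LinearMap.mul k H)

@[simp] theorem diagAct_tmul (a : A) (h : H) (p : P) (g : H) :
    diagAct k H A P (a ⊗ₜ h) (p ⊗ₜ g) = (a • p) ⊗ₜ (h * g) := rfl

variable (k H A P) in
/-- A left-right `(A, H)`-module: a left `A`-module and right `H`-comodule `P` with
`ρ(ap) = a₀p₀ ⊗ a₁p₁`. -/
class LeftRightHopfModule [RightComoduleAlgebra k H A] extends RightComodule k H P where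
  coact_smul : ∀ (a : A) (p : P), toRightComodule.coact (a • p) =
    diagAct k H A P (RightComodule.coact k H a) (toRightComodule.coact p)

end HopfModules

section InducedModule

variable (k : Type v) (H A : Type u) [CommRing k] [Ring H] [HopfAlgebra k H] [Ring A] [Algebra k A]
  [RightComoduleAlgebra k H A] (M : Type u) [AddCommGroup M] [Module k M]
  [Module (coinvariants k H A) M] [IsScalarTower k (coinvariants k H A) M]

/-- The `k`-linear map `A ⊗_k M → (A ⊗_B M) ⊗ H`, `a ⊗ m ↦ (a₀ ⊗_B m) ⊗ a₁`. -/
def preCoact : A ⊗[k] M →ₗ[k] RelTensor (coinvariants k H A) M ⊗[k] H :=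
  ((RelTensor.proj (coinvariants k H A) M).restrictScalars k).rTensor H ∘ₗ
    (TensorProduct.rightComm k A H M).toLinearMap ∘ₗ (coact k H).rTensor M

theorem preCoact_smul (a : A) (x : A ⊗[k] M) :
    preCoact k H A M (a • x) = diagAct k H A _ (coact k H a) (preCoact k H A M x) := by
  induction x with
  | zero => simp
  | add x y hx hy => simp [smul_add, hx, hy]
  | tmul c m =>
    simp only [preCoact, TensorProduct.smul_tmul', LinearMap.comp_apply, LinearMap.rTensor_tmul,
      smul_eq_mul, RightComoduleAlgebra.coact_mul, LinearEquiv.coe_coe]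
    generalize (coact k H a : A ⊗[k] H) = y
    generalize (coact k H c : A ⊗[k] H) = z
    induction y with
    | zero => simp
    | add x y hx hy => simp [add_mul, TensorProduct.add_tmul, hx, hy]
    | tmul p q =>
      induction z with
      | zero => simp
      | add x y hx hy => simp [mul_add, TensorProduct.add_tmul, hx, hy]
      | tmul r s => rw [Algebra.TensorProduct.tmul_mul_tmul]; rfl

theorem preCoact_eq_zero (x : A ⊗[k] M) (hx : x ∈ balanced (coinvariants k H A) M) :
    preCoact k H A M x = 0 := by
  induction hx using Submodule.span_induction with
  | zero => simp
  | add x y _ _ hx hy => simp [hx, hy]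
  | smul a x _ hx => simp [preCoact_smul, hx]
  | mem x hx =>
    obtain ⟨a, b, m, rfl⟩ := hx
    have hb : coact k H (b : A) = (b : A) ⊗ₜ[k] (1 : H) := b.2
    simp only [map_sub, sub_eq_zero, preCoact, LinearMap.comp_apply, LinearMap.rTensor_tmul,
      RightComoduleAlgebra.coact_mul, LinearEquiv.coe_coe, hb]
    generalize (coact k H a : A ⊗[k] H) = y
    induction y with
    | zero => simp
    | add x y hx hy => simp [add_mul, TensorProduct.add_tmul, hx, hy]
    | tmul p q =>
      simp only [Algebra.TensorProduct.tmul_mul_tmul, TensorProduct.rightComm_tmul, mul_one,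
        LinearMap.rTensor_tmul]
      congr 1
      exact (RelTensor.tmul_smul _ p b m).symm

/-- The coaction `a ⊗_B m ↦ (a₀ ⊗_B m) ⊗ a₁` on `A ⊗_B M`. -/
def inducedCoact :
    RelTensor (coinvariants k H A) M →ₗ[k] RelTensor (coinvariants k H A) M ⊗[k] H :=
  Submodule.liftQ ((balanced (coinvariants k H A) M).restrictScalars k) (preCoact k H A M)
    (preCoact_eq_zero k H A M)

/-- The map `a ↦ a ⊗_B m`. -/
def tmulHom (m : M) : A →ₗ[k] RelTensor (coinvariants k H A) M :=
  (RelTensor.proj (coinvariants k H A) M).restrictScalars k ∘ₗ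
    (TensorProduct.mk k A M).flip m

theorem inducedCoact_tmul (a : A) (m : M) :
    inducedCoact k H A M (RelTensor.tmul _ a m) =
      (tmulHom k H A M m).rTensor H (coact k H a) := by
  change preCoact k H A M (a ⊗ₜ m) = _
  simp only [preCoact, LinearMap.comp_apply, LinearMap.rTensor_tmul, LinearEquiv.coe_coe]
  generalize (coact k H a : A ⊗[k] H) = y
  induction y with
  | zero => simp
  | add x y hx hy => simp [TensorProduct.add_tmul, hx, hy]
  | tmul p q => rfl

instance : LeftRightHopfModule k H A (RelTensor (coinvariants k H A) M) where
  coact := inducedCoact k H A M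
  coassoc := by
    ext x
    induction x using RelTensor.induction_on with
    | add x y hx hy => simp only [map_add, hx, hy]
    | tmul a m =>
      have h := congrArg (TensorProduct.map (tmulHom k H A M m) LinearMap.id)
        (LinearMap.congr_fun (RightComodule.coassoc (k := k) (H := H) (V := A)) a)
      simp only [LinearMap.comp_apply, inducedCoact_tmul, LinearEquiv.coe_coe] at h ⊢
      convert h using 1
      · generalize (coact k H a : A ⊗[k] H) = y
        induction y with
        | zero => simp
        | add x y hx hy => simp only [map_add, hx, hy]
        | tmul p q =>
          simp only [LinearMap.rTensor_tmul]
          change TensorProduct.assoc k _ _ _ (inducedCoact k H A M (RelTensor.tmul _ p m) ⊗ₜ q) = _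
          rw [inducedCoact_tmul]
          generalize (coact k H p : A ⊗[k] H) = y
          induction y with
          | zero => simp
          | add x y hx hy => simp only [map_add, TensorProduct.add_tmul, hx, hy]
          | tmul p q => rfl
      · generalize (coact k H a : A ⊗[k] H) = y
        induction y with
        | zero => simp
        | add x y hx hy => simp only [map_add, hx, hy]
        | tmul p q => rfl
  lTensor_counit x := by
    induction x using RelTensor.induction_on with
    | add x y hx hy => simp only [map_add, hx, hy, TensorProduct.add_tmul]
    | tmul a m =>
      have h := congrArg (TensorProduct.map (tmulHom k H A M m) LinearMap.id)
        (RightComodule.lTensor_counit (k := k) (H := H) (V := A) a)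
      rw [inducedCoact_tmul]
      refine Eq.trans ?_ h
      generalize (coact k H a : A ⊗[k] H) = y
      induction y with
      | zero => simp
      | add x y hx hy => simp only [map_add, hx, hy]
      | tmul p q => rfl
  coact_smul a x := by
    obtain ⟨x, rfl⟩ := RelTensor.proj_surjective _ x
    exact preCoact_smul k H A M a x

end InducedModule


section Projective

variable {k : Type v} {H W W' : Type u} [CommRing k] [AddCommGroup H] [Module k H]
  [AddCommGroup W] [Module k W] [AddCommGroup W'] [Module k W']

/-- The contraction `W ⊗ H → W`, `w ⊗ h ↦ φ(h) w`. -/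
def contract (W : Type u) [AddCommGroup W] [Module k W] (φ : H →ₗ[k] k) : W ⊗[k] H →ₗ[k] W :=
  (TensorProduct.rid k W).toLinearMap ∘ₗ φ.lTensor W

@[simp] theorem contract_tmul (φ : H →ₗ[k] k) (w : W) (h : H) :
    contract W φ (w ⊗ₜ h) = φ h • w := by
  simp [contract]

theorem contract_rTensor (φ : H →ₗ[k] k) (f : W →ₗ[k] W') (z : W ⊗[k] H) :
    contract W' φ (f.rTensor H z) = f (contract W φ z) := by
  induction z with
  | zero => simp
  | tmul w h => simp
  | add x y hx hy => simp [hx, hy]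

theorem eq_zero_of_contract [Module.Projective k H] (z : W ⊗[k] H)
    (hz : ∀ φ : H →ₗ[k] k, contract W φ z = 0) : z = 0 := by
  classical
  obtain ⟨s, hs⟩ := Module.projective_def'.1 (inferInstance : Module.Projective k H)
  have h1 : s.lTensor W z = 0 := by
    apply (TensorProduct.finsuppScalarRight k k W H).injective
    ext i
    rw [TensorProduct.finsuppScalarRight_apply, map_zero, Finsupp.zero_apply,
      ← LinearMap.comp_apply, ← LinearMap.lTensor_comp]
    exact hz _
  have h2 : (Finsupp.linearCombination k (id : H → H)).lTensor W (s.lTensor W z) = z := by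
    rw [← LinearMap.comp_apply, ← LinearMap.lTensor_comp, hs, LinearMap.lTensor_id,
      LinearMap.id_apply]
  rw [← h2, h1, map_zero]

theorem eq_of_contract [Module.Projective k H] (y z : W ⊗[k] H)
    (h : ∀ φ : H →ₗ[k] k, contract W φ y = contract W φ z) : y = z :=
  sub_eq_zero.1 (eq_zero_of_contract _ fun φ => by rw [map_sub, h, sub_self])

theorem mem_range_of_contract [Module.Projective k H] (V : Submodule k W) (z : W ⊗[k] H)
    (hz : ∀ φ : H →ₗ[k] k, contract W φ z ∈ V) : ∃ y : V ⊗[k] H, V.subtype.rTensor H y = z := by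
  have hex : Function.Exact (V.subtype.rTensor H) (V.mkQ.rTensor H) :=
    rTensor_exact H (LinearMap.exact_subtype_mkQ V) (Submodule.mkQ_surjective V)
  refine (hex z).1 (eq_zero_of_contract _ fun φ => ?_)
  rw [contract_rTensor]
  simpa using hz φ

end Projective

section Antipode

variable {k : Type v} {H : Type u} [CommRing k] [Ring H] [HopfAlgebra k H]

variable (k H) in
/-- The composite inverse of the antipode. -/
def antipodeInv [BijectiveAntipode k H] : H →ₗ[k] H :=
  (LinearEquiv.ofBijective (HopfAlgebra.antipode k (A := H)) BijectiveAntipode.bijective).symm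

theorem antipodeInv_antipode [BijectiveAntipode k H] (h : H) :
    antipodeInv k H (HopfAlgebra.antipode k h) = h :=
  LinearEquiv.ofBijective_symm_apply_apply _ h

theorem antipode_antipodeInv [BijectiveAntipode k H] (h : H) :
    HopfAlgebra.antipode k (antipodeInv k H h) = h :=
  LinearEquiv.apply_ofBijective_symm_apply _ h

/-- `S⁻¹(h₂) h₁ = ε(h)`. -/
theorem antipodeInv_mul [BijectiveAntipode k H] (h : H) :
    TensorProduct.lift ((LinearMap.mul k H ∘ₗ antipodeInv k H).flip)
      (Coalgebra.comul (R := k) h) = algebraMap k H (Coalgebra.counit (R := k) h) := by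
  apply BijectiveAntipode.bijective (k := k) (H := H).1
  have h1 : ∀ D : H ⊗[k] H, HopfAlgebra.antipode k
      (TensorProduct.lift ((LinearMap.mul k H ∘ₗ antipodeInv k H).flip) D) =
      LinearMap.mul' k H ((HopfAlgebra.antipode k (A := H)).rTensor H D) := fun D => by
    induction D with
    | zero => simp
    | add x y hx hy => simp only [map_add, hx, hy]
    | tmul a b => simp [HopfAlgebra.antipode_mul_antidistrib, antipode_antipodeInv]
  rw [h1, HopfAlgebra.mul_antipode_rTensor_comul_apply, Algebra.algebraMap_eq_smul_one, map_smul,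
    HopfAlgebra.antipode_one]

end Antipode

section Twist

variable {k : Type v} {H P X : Type u} [CommRing k] [Ring H] [HopfAlgebra k H]
  [AddCommGroup P] [Module k P] [RightComodule k H P] [AddCommGroup X] [Module k X]

/-- For a left `H`-module `X` (given by `r`) and `K : V → X`, the map `v ⊗ h ↦ h K(v)`. -/
def twist {V : Type u} [AddCommGroup V] [Module k V] (r : H →ₐ[k] Module.End k X) :
    (V →ₗ[k] X) →ₗ[k] V ⊗[k] H →ₗ[k] X where
  toFun K := TensorProduct.lift (r.toLinearMap.flip ∘ₗ K)
  map_add' _ _ := by ext; simp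
  map_smul' _ _ := by ext; simp

@[simp] theorem twist_tmul {V : Type u} [AddCommGroup V] [Module k V]
    (r : H →ₐ[k] Module.End k X) (K : V →ₗ[k] X) (v : V) (h : H) :
    twist r K (v ⊗ₜ h) = r h (K v) := rfl

/-- For a left `H`-module `X` (given by `r`), a map `K : P → X` is determined by the map
`p ↦ p₁ K(p₀)`. -/
theorem twist_injective [BijectiveAntipode k H] (r : H →ₐ[k] Module.End k X) (K T : P →ₗ[k] X)
    (hK : ∀ p, twist r K (coact k H p) =
      twist r T (coact k H p)) : K = T := by
  ext p
  let L : (P →ₗ[k] X) → (P ⊗[k] (H ⊗[k] H) →ₗ[k] X) := fun K =>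
    twist r K ∘ₗ
      (TensorProduct.lift ((LinearMap.mul k H ∘ₗ antipodeInv k H).flip)).lTensor P
  have h2 : ∀ (K : P →ₗ[k] X) (h : H) (w : P ⊗[k] H),
      L K (TensorProduct.assoc k P H H (w ⊗ₜ h)) =
        r (antipodeInv k H h) (twist r K w) := fun K h w => by
    induction w with
    | zero => simp
    | add x y hx hy => simp only [map_add, TensorProduct.add_tmul, hx, hy]
    | tmul a b => simp [L]
  have h1 : ∀ z : P ⊗[k] H, L K (TensorProduct.assoc k P H H ((coact k H).rTensor H z)) =
      L T (TensorProduct.assoc k P H H ((coact k H).rTensor H z)) := by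
    intro z
    induction z with
    | zero => simp
    | add x y hx hy => simp only [map_add, hx, hy]
    | tmul q h => rw [LinearMap.rTensor_tmul, h2, h2, hK]
  have h3 : ∀ (K : P →ₗ[k] X) (z : P ⊗[k] H),
      L K ((Coalgebra.comul (R := k) (A := H)).lTensor P z) =
        K (contract P (Coalgebra.counit (R := k) (A := H)) z) := fun K z => by
    induction z with
    | zero => simp
    | add x y hx hy => simp only [map_add, hx, hy]
    | tmul q h =>
      simp only [LinearMap.lTensor_tmul, L, LinearMap.comp_apply, antipodeInv_mul]
      simp [Algebra.algebraMap_eq_smul_one]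
  have h4 := LinearMap.congr_fun (RightComodule.coassoc (k := k) (H := H) (V := P)) p
  simp only [LinearMap.comp_apply, LinearEquiv.coe_coe] at h4
  have h5 := h1 (coact k H p)
  rw [h4, h3, h3, contract, LinearMap.comp_apply, RightComodule.lTensor_counit] at h5
  simpa using h5

end Twist


section RationalEndomorphisms

variable (k : Type v) (H A P : Type u) [CommRing k] [Ring H] [HopfAlgebra k H] [Ring A]
  [Algebra k A] [AddCommGroup P] [Module k P] [Module A P] [IsScalarTower k A P]

/-- An element of `End_A(P)^op`, seen as a `k`-linear endomorphism of `P`. -/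
def opToEnd : (Module.End A P)ᵐᵒᵖ →ₗ[k] Module.End k P :=
  LinearMap.restrictScalarsₗ k A P P k ∘ₗ (MulOpposite.opLinearEquiv k).symm.toLinearMap

/-- The action of `f ⊗ h ∈ End_A(P)^op ⊗ H` on `P ⊗ H`, `p ⊗ g ↦ f(p) ⊗ gh`. -/
def ratAct : (Module.End A P)ᵐᵒᵖ ⊗[k] H →ₗ[k] P ⊗[k] H →ₗ[k] P ⊗[k] H :=
  TensorProduct.map₂ (opToEnd k A P) (LinearMap.mul k H).flip

variable {k H A P} in
@[simp] theorem opToEnd_apply (f : (Module.End A P)ᵐᵒᵖ) (p : P) :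
    opToEnd k A P f p = f.unop p := rfl

variable {k H A P} in
@[simp] theorem ratAct_tmul (f : (Module.End A P)ᵐᵒᵖ) (h : H) (p : P) (g : H) :
    ratAct k H A P (f ⊗ₜ h) (p ⊗ₜ g) = f.unop p ⊗ₜ (g * h) := rfl

theorem ratAct_mul (x y : (Module.End A P)ᵐᵒᵖ ⊗[k] H) (z : P ⊗[k] H) :
    ratAct k H A P (x * y) z = ratAct k H A P y (ratAct k H A P x z) := by
  induction z with
  | zero => simp
  | add a b ha hb => simp only [map_add, ha, hb]
  | tmul p g =>
    induction x with
    | zero => simp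
    | add a b ha hb => simp only [map_add, add_mul, LinearMap.add_apply, ha, hb]
    | tmul f h =>
      induction y with
      | zero => simp
      | add a b ha hb => simp only [map_add, mul_add, LinearMap.add_apply, ha, hb]
      | tmul f' h' => simp [mul_assoc]

variable [RightComodule k H P]

/-- The algebra `END_A(P)^op`, where `END_A(P)` consists of the rational `A`-linear endomorphisms
of `P`: those `f` for which there is `f₀ ⊗ f₁ ∈ End_A(P) ⊗ H` with
`ρ(f(p)) = f₀(p₀) ⊗ p₁f₁` for all `p`. -/
def RatEndOp : Subalgebra k (Module.End A P)ᵐᵒᵖ where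
  carrier := {f | ∃ x : (Module.End A P)ᵐᵒᵖ ⊗[k] H,
    ∀ p : P, coact k H (f.unop p) = ratAct k H A P x (coact k H p)}
  mul_mem' := by
    rintro f g ⟨x, hx⟩ ⟨y, hy⟩
    refine ⟨x * y, fun p => ?_⟩
    rw [ratAct_mul, ← hx, ← hy]
    rfl
  add_mem' := by
    rintro f g ⟨x, hx⟩ ⟨y, hy⟩
    refine ⟨x + y, fun p => ?_⟩
    rw [map_add, LinearMap.add_apply, ← hx, ← hy, ← map_add]
    rfl
  algebraMap_mem' c := by
    refine ⟨algebraMap k _ c ⊗ₜ 1, fun p => ?_⟩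
    have h : ∀ z : P ⊗[k] H, ratAct k H A P (algebraMap k _ c ⊗ₜ 1) z = c • z := fun z => by
      induction z with
      | zero => simp
      | add a b ha hb => simp only [map_add, ha, hb, smul_add]
      | tmul p g => simp [MulOpposite.algebraMap_apply, TensorProduct.smul_tmul']
    rw [h, ← map_smul]
    simp [MulOpposite.algebraMap_apply]

/-- The inclusion `END_A(P)^op ⊗ H → End_A(P)^op ⊗ H`. -/
def ratIncl : RatEndOp k H A P ⊗[k] H →ₐ[k] (Module.End A P)ᵐᵒᵖ ⊗[k] H :=
  Algebra.TensorProduct.map (RatEndOp k H A P).val (AlgHom.id k H)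

/-- Evaluation `f ⊗ h ↦ (p ↦ f(p) ⊗ h)`. -/
def evalTensor : (Module.End A P)ᵐᵒᵖ ⊗[k] H →ₗ[k] P →ₗ[k] P ⊗[k] H :=
  (LinearMap.rTensorHom H ∘ₗ (opToEnd k A P).flip).flip

variable {k H A P} in
@[simp] theorem evalTensor_tmul (f : (Module.End A P)ᵐᵒᵖ) (h : H) (p : P) :
    evalTensor k H A P (f ⊗ₜ h) p = f.unop p ⊗ₜ h := rfl

/-- Left multiplication of `H` on the right factor of `W ⊗ H`. -/
def leftMul (W : Type u) [AddCommGroup W] [Module k W] : H →ₐ[k] Module.End k (W ⊗[k] H) :=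
  (Module.End.lTensorAlgHom k H W).comp (Algebra.lmul k H)

variable {k H} in
@[simp] theorem leftMul_tmul (W : Type u) [AddCommGroup W] [Module k W] (h g : H) (w : W) :
    leftMul k H W h (w ⊗ₜ g) = w ⊗ₜ (h * g) := rfl

variable {k H} in
theorem leftMul_rTensor {W W' : Type u} [AddCommGroup W] [Module k W] [AddCommGroup W']
    [Module k W'] (f : W →ₗ[k] W') (h : H) (z : W ⊗[k] H) :
    leftMul k H W' h (f.rTensor H z) = f.rTensor H (leftMul k H W h z) := by
  induction z with
  | zero => simp
  | add a b ha hb => simp only [map_add, ha, hb]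
  | tmul p g => rfl

theorem lift_evalTensor (x : (Module.End A P)ᵐᵒᵖ ⊗[k] H) (z : P ⊗[k] H) :
    twist (leftMul k H P) (evalTensor k H A P x) z =
      ratAct k H A P x z := by
  induction z with
  | zero => simp
  | add a b ha hb => simp only [map_add, ha, hb]
  | tmul p g =>
    induction x with
    | zero => simp
    | add a b ha hb =>
      simp only [map_add, LinearMap.add_apply, ha, hb]
    | tmul f h => simp

theorem contract_evalTensor (φ : H →ₗ[k] k) (x : (Module.End A P)ᵐᵒᵖ ⊗[k] H) (p : P) :
    contract P φ (evalTensor k H A P x p) = (contract _ φ x).unop p := by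
  induction x with
  | zero => simp
  | add a b ha hb => simp only [map_add, LinearMap.add_apply, ha, hb, MulOpposite.unop_add]
  | tmul f h => simp

theorem ratAct_coact_injective [BijectiveAntipode k H] [Module.Projective k H]
    (x : (Module.End A P)ᵐᵒᵖ ⊗[k] H) (hx : ∀ p, ratAct k H A P x (coact k H p) = 0) : x = 0 := by
  have h := twist_injective (leftMul k H P) (evalTensor k H A P x) 0 fun p => by
    rw [lift_evalTensor, hx]
    simp
  refine eq_zero_of_contract _ fun φ => MulOpposite.unop_injective (LinearMap.ext fun p => ?_)
  rw [← contract_evalTensor, h]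
  simp

/-- The map `f ⊗ h ⊗ h' ↦ (v ↦ (f ⊗ h)v ⊗ h')`. -/
def ratAct' : ((Module.End A P)ᵐᵒᵖ ⊗[k] H) ⊗[k] H →ₗ[k] P ⊗[k] H →ₗ[k] (P ⊗[k] H) ⊗[k] H :=
  (LinearMap.rTensorHom H ∘ₗ (ratAct k H A P).flip).flip

theorem lift_ratAct' (f : (Module.End A P)ᵐᵒᵖ) (D G : H ⊗[k] H) (p : P) :
    twist (leftMul k H (P ⊗[k] H)) (ratAct' k H A P ((TensorProduct.assoc k _ H H).symm (f ⊗ₜ D)))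
        ((TensorProduct.assoc k P H H).symm (p ⊗ₜ G)) =
      (TensorProduct.assoc k P H H).symm (f.unop p ⊗ₜ (G * D)) := by
  induction G with
  | zero => simp
  | add a b ha hb => simp only [TensorProduct.tmul_add, map_add, ha, hb, add_mul]
  | tmul a b =>
    induction D with
    | zero => simp
    | add c d hc hd =>
      simp only [TensorProduct.tmul_add, map_add, mul_add, LinearMap.add_apply, hc, hd]
    | tmul c d => rw [Algebra.TensorProduct.tmul_mul_tmul]; rfl

/-- If `f` is rational with `f₀ ⊗ f₁`, then each `φ(f₁)f₀` is rational with `f₀ ⊗ f₁φ(f₂)`. -/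
theorem contract_rational [BijectiveAntipode k H] (x : (Module.End A P)ᵐᵒᵖ ⊗[k] H)
    (f : (Module.End A P)ᵐᵒᵖ) (hx : ∀ p, coact k H (f.unop p) = ratAct k H A P x (coact k H p))
    (φ : H →ₗ[k] k) (p : P) :
    coact k H ((contract _ φ x).unop p) =
      ratAct k H A P ((contract H φ ∘ₗ Coalgebra.comul).lTensor _ x) (coact k H p) := by
  let N : (Module.End A P)ᵐᵒᵖ ⊗[k] H →ₗ[k] P ⊗[k] H →ₗ[k] (P ⊗[k] H) ⊗[k] H :=
    ratAct' k H A P ∘ₗ (TensorProduct.assoc k _ H H).symm.toLinearMap ∘ₗ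
      (Coalgebra.comul (R := k) (A := H)).lTensor _
  let K : P →ₗ[k] (P ⊗[k] H) ⊗[k] H := (coact k H).rTensor H ∘ₗ evalTensor k H A P x
  have hN : ∀ z, twist (leftMul k H (P ⊗[k] H)) (N x)
      ((TensorProduct.assoc k P H H).symm ((Coalgebra.comul (R := k) (A := H)).lTensor P z)) =
      (TensorProduct.assoc k P H H).symm
        ((Coalgebra.comul (R := k) (A := H)).lTensor P (ratAct k H A P x z)) := by
    intro z
    clear hx K
    induction z with
    | zero => simp
    | add a b ha hb => simp only [map_add, ha, hb]
    | tmul q g =>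
      induction x with
      | zero => simp
      | add a b ha hb => simp only [map_add, LinearMap.add_apply, ha, hb]
      | tmul f h =>
        simp only [N, LinearMap.lTensor_tmul, LinearMap.comp_apply, LinearEquiv.coe_coe,
          lift_ratAct', ratAct_tmul, Bialgebra.comul_mul]
  have hT : ∀ z, twist (leftMul k H (P ⊗[k] H)) (N x ∘ₗ coact k H) z =
      twist (leftMul k H (P ⊗[k] H)) (N x)
        ((coact k H).rTensor H z) := by
    intro z
    induction z with
    | zero => simp
    | add a b ha hb => simp only [map_add, ha, hb]
    | tmul q g => simp
  have hK : ∀ z, twist (leftMul k H (P ⊗[k] H)) K z =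
      (coact k H).rTensor H (ratAct k H A P x z) := by
    intro z
    rw [← lift_evalTensor]
    induction z with
    | zero => simp
    | add a b ha hb => simp only [map_add, ha, hb]
    | tmul q g =>
      simp only [twist_tmul, LinearMap.comp_apply, K]
      exact leftMul_rTensor _ _ _
  have hTK : K = N x ∘ₗ coact k H := twist_injective (leftMul k H (P ⊗[k] H)) _ _ fun q => by
    have h4 := fun q => LinearMap.congr_fun
      (RightComodule.coassoc (k := k) (H := H) (V := P)) q
    simp only [LinearMap.comp_apply, LinearEquiv.coe_coe, ← LinearEquiv.eq_symm_apply] at h4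
    rw [hK, hT, h4, hN, ← hx, h4]
  have h := congrArg (contract _ φ) (LinearMap.congr_fun hTK p)
  simp only [K, LinearMap.comp_apply, contract_rTensor, contract_evalTensor] at h
  rw [h]
  change contract _ φ (((ratAct k H A P).flip (coact k H p)).rTensor H _) = _
  rw [contract_rTensor, LinearMap.flip_apply]
  congr 2
  simp only [LinearMap.comp_apply, LinearEquiv.coe_coe]
  clear h hTK hK hT hN K N hx
  induction x with
  | zero => simp
  | add a b ha hb => simp only [map_add, ha, hb]
  | tmul f h =>
    simp only [LinearMap.lTensor_tmul, LinearMap.comp_apply]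
    generalize (Coalgebra.comul (R := k) h : H ⊗[k] H) = D
    induction D with
    | zero => simp
    | add a b ha hb => simp only [map_add, ha, hb, TensorProduct.tmul_add]
    | tmul a b => simp [TensorProduct.tmul_smul]

end RationalEndomorphisms


section EndComoduleAlgebra

variable {k : Type v} {H A P : Type u} [CommRing k] [Ring H] [HopfAlgebra k H] [Ring A]
  [Algebra k A] [AddCommGroup P] [Module k P] [Module A P] [IsScalarTower k A P]
  [RightComodule k H P] [BijectiveAntipode k H] [Module.Projective k H]

theorem ratIncl_injective : Function.Injective (ratIncl k H A P) :=
  Module.Flat.rTensor_preserves_injective_linearMap (M := H)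
    (RatEndOp k H A P).val.toLinearMap Subtype.val_injective

theorem ratIncl_eq (y : RatEndOp k H A P ⊗[k] H) :
    ratIncl k H A P y = (RatEndOp k H A P).val.toLinearMap.rTensor H y := rfl

theorem contract_ratIncl (φ : H →ₗ[k] k) (y : RatEndOp k H A P ⊗[k] H) :
    contract _ φ (ratIncl k H A P y) = (contract _ φ y : RatEndOp k H A P) := by
  rw [ratIncl_eq, contract_rTensor]
  rfl

theorem ratEndOp_ext (y z : RatEndOp k H A P ⊗[k] H)
    (h : ∀ p, ratAct k H A P (ratIncl k H A P y) (coact k H p) =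
      ratAct k H A P (ratIncl k H A P z) (coact k H p)) : y = z := by
  apply ratIncl_injective
  rw [← sub_eq_zero]
  refine ratAct_coact_injective k H A P _ fun p => ?_
  rw [map_sub, LinearMap.sub_apply, h, sub_self]

theorem ratEndOp_exists (f : RatEndOp k H A P) : ∃ y : RatEndOp k H A P ⊗[k] H,
    ∀ p, coact k H (f.1.unop p) = ratAct k H A P (ratIncl k H A P y) (coact k H p) := by
  obtain ⟨x, hx⟩ := f.2
  obtain ⟨y, rfl⟩ := mem_range_of_contract (Subalgebra.toSubmodule (RatEndOp k H A P)) x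
    fun φ => ⟨_, contract_rational k H A P x f.1 hx φ⟩
  exact ⟨y, hx⟩

variable (k H A P) in
/-- The coaction `f ↦ f₀ ⊗ f₁` of `END_A(P)^op`, characterized by `ρ(f(p)) = f₀(p₀) ⊗ p₁f₁`. -/
def ratCoact : RatEndOp k H A P →ₗ[k] RatEndOp k H A P ⊗[k] H where
  toFun f := (ratEndOp_exists f).choose
  map_add' f g := ratEndOp_ext _ _ fun p => by
    rw [← (ratEndOp_exists (f + g)).choose_spec, map_add, map_add, LinearMap.add_apply,
      ← (ratEndOp_exists f).choose_spec, ← (ratEndOp_exists g).choose_spec, ← map_add]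
    rfl
  map_smul' c f := ratEndOp_ext _ _ fun p => by
    rw [← (ratEndOp_exists (c • f)).choose_spec, map_smul, map_smul, LinearMap.smul_apply,
      RingHom.id_apply, ← (ratEndOp_exists f).choose_spec, ← map_smul]
    rfl

theorem ratCoact_spec (f : RatEndOp k H A P) (p : P) :
    coact k H (f.1.unop p) =
      ratAct k H A P (ratIncl k H A P (ratCoact k H A P f)) (coact k H p) :=
  (ratEndOp_exists f).choose_spec p

/-- The coaction is determined by `ρ(f(p)) = f₀(p₀) ⊗ p₁f₁`. -/
theorem ratCoact_unique (f : RatEndOp k H A P) (y : RatEndOp k H A P ⊗[k] H)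
    (hy : ∀ p, coact k H (f.1.unop p) = ratAct k H A P (ratIncl k H A P y) (coact k H p)) :
    ratCoact k H A P f = y :=
  ratEndOp_ext _ _ fun p => by rw [← ratCoact_spec, hy]

theorem ratIncl_lTensor (ψ : H →ₗ[k] H) (y : RatEndOp k H A P ⊗[k] H) :
    ratIncl k H A P (ψ.lTensor _ y) = ψ.lTensor _ (ratIncl k H A P y) := by
  induction y with
  | zero => simp
  | add a b ha hb => simp only [map_add, ha, hb]
  | tmul a b => rfl

theorem ratCoact_contract (f : RatEndOp k H A P) (φ : H →ₗ[k] k) :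
    ratCoact k H A P (contract _ φ (ratCoact k H A P f)) =
      (contract H φ ∘ₗ Coalgebra.comul).lTensor _ (ratCoact k H A P f) := by
  refine ratCoact_unique _ _ fun p => ?_
  rw [ratIncl_lTensor, ← contract_rational k H A P _ f.1 (ratCoact_spec f), contract_ratIncl]

theorem contract_assoc_symm (W : Type u) [AddCommGroup W] [Module k W] (φ : H →ₗ[k] k)
    (y : W ⊗[k] H) :
    contract (W ⊗[k] H) φ ((TensorProduct.assoc k W H H).symm (Coalgebra.comul.lTensor W y)) =
      (contract H φ ∘ₗ Coalgebra.comul).lTensor W y := by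
  induction y with
  | zero => simp
  | add a b ha hb => simp only [map_add, ha, hb]
  | tmul w h =>
    simp only [LinearMap.lTensor_tmul, LinearMap.comp_apply]
    generalize (Coalgebra.comul (R := k) h : H ⊗[k] H) = D
    induction D with
    | zero => simp
    | add a b ha hb => simp only [map_add, ha, hb, TensorProduct.tmul_add]
    | tmul a b => simp [TensorProduct.tmul_smul]

theorem contract_counit_ratAct (x : (Module.End A P)ᵐᵒᵖ ⊗[k] H) (z : P ⊗[k] H) :
    contract P (Coalgebra.counit (R := k) (A := H)) (ratAct k H A P x z) =
      (contract _ (Coalgebra.counit (R := k) (A := H)) x).unop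
        (contract P (Coalgebra.counit (R := k) (A := H)) z) := by
  induction z with
  | zero => simp
  | add a b ha hb => simp only [map_add, ha, hb]
  | tmul p g =>
    induction x with
    | zero => simp
    | add a b ha hb =>
      simp only [map_add, LinearMap.add_apply, ha, hb, MulOpposite.unop_add]
    | tmul f h => 
      simp only [ratAct_tmul, contract_tmul, Bialgebra.counit_mul, MulOpposite.unop_smul,
        LinearMap.smul_apply, mul_smul]
      rw [smul_comm, LinearMap.map_smul_of_tower]

theorem contract_counit_coact {V : Type u} [AddCommGroup V] [Module k V] [RightComodule k H V]
    (x : V) : contract V (Coalgebra.counit (R := k) (A := H)) (coact k H x) = x := by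
  rw [contract, LinearMap.comp_apply, RightComodule.lTensor_counit]
  simp

theorem contract_counit_ratCoact (f : RatEndOp k H A P) :
    contract _ (Coalgebra.counit (R := k) (A := H)) (ratCoact k H A P f) = f := by
  apply Subtype.ext
  rw [← contract_ratIncl]
  refine MulOpposite.unop_injective (LinearMap.ext fun p => ?_)
  have h := congrArg (contract P (Coalgebra.counit (R := k) (A := H))) (ratCoact_spec f p)
  rw [contract_counit_ratAct, contract_counit_coact, contract_counit_coact] at h
  exact h.symm

/-- `END_A(P)^op` is a right `H`-comodule algebra. -/
instance : RightComoduleAlgebra k H (RatEndOp k H A P) where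
  coact := ratCoact k H A P
  coassoc := by
    ext1 f
    simp only [LinearMap.comp_apply, LinearEquiv.coe_coe, ← LinearEquiv.eq_symm_apply]
    refine eq_of_contract (H := H) (W := RatEndOp k H A P ⊗[k] H) _ _ fun φ => ?_
    rw [contract_rTensor, contract_assoc_symm, ratCoact_contract]
  lTensor_counit f := by
    apply (TensorProduct.rid k (RatEndOp k H A P)).injective
    have h := contract_counit_ratCoact f
    rw [contract, LinearMap.comp_apply] at h
    simpa using h
  coact_one := ratCoact_unique _ _ fun p => by
    rw [map_one]
    have h : ∀ z : P ⊗[k] H, ratAct k H A P 1 z = z := fun z => by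
      induction z with
      | zero => simp
      | add a b ha hb => simp only [map_add, ha, hb]
      | tmul p g => simp [Algebra.TensorProduct.one_def]
    rw [h]
    rfl
  coact_mul f g := ratCoact_unique _ _ fun p => by
    rw [map_mul, ratAct_mul, ← ratCoact_spec, ← ratCoact_spec]
    rfl

end EndComoduleAlgebra


section ConvolutionCategory

variable (k : Type v) (H A : Type u) [CommRing k] [Ring H] [HopfAlgebra k H] [Ring A] [Algebra k A]
  [RightComoduleAlgebra k H A]

/-- Labels for the two objects of the categories below. -/
inductive Obj
  | one
  | two

variable {k H A} in
/-- The convolution product `(f * g)(h) = f(h₁) g(h₂)`. -/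
def conv (f g : H →ₗ[k] A) : H →ₗ[k] A :=
  LinearMap.mul' k A ∘ₗ TensorProduct.map f g ∘ₗ Coalgebra.comul

variable {k H A} in
/-- The condition for `f : H → A` to be a morphism `i ⟶ j`:
* `1 ⟶ 1`: `ρ(f(h)) = f(h) ⊗ 1`;
* `2 ⟶ 1`: `ρ(f(h)) = f(h₁) ⊗ h₂`;
* `1 ⟶ 2`: `ρ(f(h)) = f(h₂) ⊗ S(h₁)`;
* `2 ⟶ 2`: `ρ(f(h)) = f(h₂) ⊗ S(h₁)h₃`. -/
def IsConvHom (f : H →ₗ[k] A) : Obj → Obj → Prop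
  | .one, .one => ∀ h : H, coact k H (f h) = f h ⊗ₜ 1
  | .two, .one => ∀ h : H, coact k H (f h) = f.rTensor H (Coalgebra.comul h)
  | .one, .two => ∀ h : H, coact k H (f h) =
      TensorProduct.map f (HopfAlgebra.antipode k) (TensorProduct.comm k H H (Coalgebra.comul h))
  | .two, .two => ∀ h : H, coact k H (f h) =
      TensorProduct.map f (LinearMap.mul' k H ∘ₗ (HopfAlgebra.antipode k).rTensor H)
        (TensorProduct.leftComm k H H H
          ((Coalgebra.comul (R := k) (A := H)).lTensor H (Coalgebra.comul h)))

/-- The `k`-module of morphisms `i ⟶ j`. -/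
def convHom (i j : Obj) : Submodule k (H →ₗ[k] A) where
  carrier := {f | IsConvHom f i j}
  zero_mem' := by cases i <;> cases j <;> intro h <;> simp [TensorProduct.map_zero_left]
  add_mem' {f g} hf hg := by
    cases i <;> cases j <;> intro h <;> have hf := hf h <;> have hg := hg h <;>
      simp [TensorProduct.map_add_left, TensorProduct.add_tmul, hf, hg]
  smul_mem' c f hf := by
    cases i <;> cases j <;> intro h <;> have hf := hf h <;>
      simp [TensorProduct.map_smul_left, TensorProduct.smul_tmul', hf]

open WithConv (toConv)

/-- The factors contributed by the source of a morphism. -/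
def convR : Obj → WithConv (H →ₗ[k] A ⊗[k] H)
  | .one => 1
  | .two => toConv (Algebra.TensorProduct.includeRight : H →ₐ[k] A ⊗[k] H).toLinearMap

/-- The factors contributed by the target of a morphism. -/
def convL : Obj → WithConv (H →ₗ[k] A ⊗[k] H)
  | .one => 1
  | .two => toConv ((Algebra.TensorProduct.includeRight : H →ₐ[k] A ⊗[k] H).toLinearMap ∘ₗ
      HopfAlgebra.antipode k)

theorem convR_mul_convL (i : Obj) : convR k H A i * convL k H A i = 1 := by
  cases i
  · simp [convR, convL]
  · have h := LinearMap.algHom_comp_convMul_distrib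
      (Algebra.TensorProduct.includeRight : H →ₐ[k] A ⊗[k] H)
      (toConv LinearMap.id) (toConv (HopfAlgebra.antipode k))
    rw [LinearMap.id_mul_antipode] at h
    apply WithConv.ofConv_injective
    refine h.symm.trans ?_
    ext x
    simp [LinearMap.convOne_def, Algebra.algebraMap_eq_smul_one, TensorProduct.smul_tmul',
      Algebra.TensorProduct.one_def]

variable {k H A} in
/-- The map `h ↦ f(h) ⊗ 1`. -/
def convI (f : H →ₗ[k] A) : WithConv (H →ₗ[k] A ⊗[k] H) :=
  toConv ((Algebra.TensorProduct.includeLeft : A →ₐ[k] A ⊗[k] H).toLinearMap ∘ₗ f)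

variable {k H A} in
theorem isConvHom_iff (f : H →ₗ[k] A) (i j : Obj) : IsConvHom f i j ↔
    toConv (coact k H ∘ₗ f) = convL k H A j * (convI f * convR k H A i) := by
  rw [← WithConv.ofConv_injective.eq_iff, LinearMap.ext_iff]
  cases i <;> cases j
  · simp [IsConvHom, convL, convR, convI]
  · refine forall_congr' fun h => ?_
    simp only [convL, convR, mul_one, LinearMap.convMul_def, LinearMap.comp_apply, convI]
    generalize (Coalgebra.comul (R := k) h : H ⊗[k] H) = D
    refine Eq.congr rfl ?_
    induction D with
    | zero => simp
    | add a b ha hb => simp only [map_add, ha, hb]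
    | tmul a b => simp
  · refine forall_congr' fun h => ?_
    simp only [convL, convR, one_mul, LinearMap.convMul_def, LinearMap.comp_apply, convI]
    generalize (Coalgebra.comul (R := k) h : H ⊗[k] H) = D
    refine Eq.congr rfl ?_
    induction D with
    | zero => simp
    | add a b ha hb => simp only [map_add, ha, hb]
    | tmul a b => simp
  · refine forall_congr' fun h => ?_
    simp only [convL, convR, LinearMap.convMul_def, LinearMap.comp_apply, convI]
    generalize (Coalgebra.comul (R := k) h : H ⊗[k] H) = D
    refine Eq.congr rfl ?_
    induction D with
    | zero => simp
    | add a b ha hb => simp only [map_add, ha, hb]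
    | tmul a b =>
      simp only [LinearMap.lTensor_tmul, TensorProduct.map_tmul, LinearMap.comp_apply]
      generalize (Coalgebra.comul (R := k) b : H ⊗[k] H) = D
      induction D with
      | zero => simp
      | add a b ha hb => simp only [map_add, TensorProduct.tmul_add, ha, hb]
      | tmul c d => simp

variable {k H A} in
theorem IsConvHom.conv {f g : H →ₗ[k] A} {i j l : Obj} (hg : IsConvHom g j l)
    (hf : IsConvHom f i j) : IsConvHom (conv g f) i l := by
  rw [isConvHom_iff] at *
  have h1 : toConv (coact k H ∘ₗ HopfGalois.conv g f) =
      toConv (coact k H ∘ₗ g) * toConv (coact k H ∘ₗ f) :=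
    congrArg toConv (LinearMap.algHom_comp_convMul_distrib (coactAlgHom k H A) (toConv g) (toConv f))
  have h2 : convI (HopfGalois.conv g f) = convI (H := H) g * convI f :=
    congrArg toConv (LinearMap.algHom_comp_convMul_distrib
      (Algebra.TensorProduct.includeLeft : A →ₐ[k] A ⊗[k] H) (toConv g) (toConv f))
  rw [h1, h2, hg, hf]
  simp only [mul_assoc]
  rw [← mul_assoc (convR k H A j), convR_mul_convL, one_mul]

variable {k H A} in
theorem isConvHom_id (i : Obj) :
    IsConvHom (Algebra.linearMap k A ∘ₗ (Coalgebra.counit (R := k) (A := H))) i i := by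
  cases i
  · intro h
    simp only [LinearMap.comp_apply, Algebra.linearMap_apply, Algebra.algebraMap_eq_smul_one,
      map_smul, RightComoduleAlgebra.coact_one]
    simp [TensorProduct.smul_tmul', Algebra.TensorProduct.one_def]
  · intro h
    have h1 : ∀ D : H ⊗[k] H, TensorProduct.map
        (Algebra.linearMap k A ∘ₗ (Coalgebra.counit (R := k) (A := H)))
        (LinearMap.mul' k H ∘ₗ (HopfAlgebra.antipode k).rTensor H)
        (TensorProduct.leftComm k H H H
          ((Coalgebra.comul (R := k) (A := H)).lTensor H D)) =
        1 ⊗ₜ LinearMap.mul' k H ((HopfAlgebra.antipode k).rTensor H D) := fun D => by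
      induction D with
      | zero => simp
      | add a b ha hb => simp only [map_add, ha, hb, TensorProduct.tmul_add]
      | tmul a b =>
        have h2 : ∀ D : H ⊗[k] H, TensorProduct.map
            (Algebra.linearMap k A ∘ₗ (Coalgebra.counit (R := k) (A := H)))
            (LinearMap.mul' k H ∘ₗ (HopfAlgebra.antipode k).rTensor H)
            (TensorProduct.leftComm k H H H (a ⊗ₜ D)) =
            1 ⊗ₜ (HopfAlgebra.antipode k a *
              TensorProduct.lid k H ((Coalgebra.counit (R := k) (A := H)).rTensor H D)) :=
          fun D => by
            induction D with
            | zero => simp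
            | add a b ha hb => simp only [map_add, ha, hb, TensorProduct.tmul_add, mul_add]
            | tmul c d => simp [Algebra.algebraMap_eq_smul_one, TensorProduct.smul_tmul]
        rw [LinearMap.lTensor_tmul, h2, Coalgebra.rTensor_counit_comul]
        simp
    rw [h1, HopfAlgebra.mul_antipode_rTensor_comul_apply]
    simp only [LinearMap.comp_apply, Algebra.linearMap_apply, Algebra.algebraMap_eq_smul_one,
      map_smul, RightComoduleAlgebra.coact_one]
    simp [Algebra.TensorProduct.one_def]

/-- The category attached to a right `H`-comodule algebra `A`: two objects `1` and `2`, morphisms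
`convHom k H A i j`, and the composite of `f : i ⟶ j` and `g : j ⟶ l` is the convolution `g * f`. -/
def ConvCat (_k : Type v) (_H _A : Type u) : Type := Obj

instance : CategoryTheory.Category (ConvCat k H A) where
  Hom i j := convHom k H A i j
  id i := ⟨_, isConvHom_id i⟩
  comp f g := ⟨conv g.1 f.1, IsConvHom.conv g.2 f.2⟩
  id_comp f := Subtype.ext (congrArg WithConv.ofConv (mul_one (toConv f.1)))
  comp_id f := Subtype.ext (congrArg WithConv.ofConv (one_mul (toConv f.1)))
  assoc f g h := Subtype.ext
    (congrArg WithConv.ofConv (mul_assoc (toConv h.1) (toConv g.1) (toConv f.1)).symm)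

instance : CategoryTheory.Preadditive (ConvCat k H A) where
  homGroup i j := inferInstanceAs (AddCommGroup (convHom k H A i j))
  add_comp _ _ _ f f' g := Subtype.ext
    (congrArg WithConv.ofConv (mul_add (toConv g.1) (toConv f.1) (toConv f'.1)))
  comp_add _ _ _ f g g' := Subtype.ext
    (congrArg WithConv.ofConv (add_mul (toConv g.1) (toConv g'.1) (toConv f.1)))

instance : CategoryTheory.Linear k (ConvCat k H A) where
  homModule i j := inferInstanceAs (Module k (convHom k H A i j))
  smul_comp _ _ _ c f g := Subtype.ext
    (congrArg WithConv.ofConv (mul_smul_comm c (toConv g.1) (toConv f.1)))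
  comp_smul _ _ _ f c g := Subtype.ext
    (congrArg WithConv.ofConv (smul_mul_assoc c (toConv g.1) (toConv f.1)))

end ConvolutionCategory


section RelativeModules

variable (k : Type v) (H : Type u) [CommRing k] [Ring H] [HopfAlgebra k H]
  (B : Type u) [Ring B] [Algebra k B]

/-- Objects of the category `_B M^H`: left `B`-modules with a right `H`-coaction such that
`ρ(bx) = b x₀ ⊗ x₁`. -/
structure BComod where
  carrier : Type u
  [addCommGroup : AddCommGroup carrier]
  [moduleBase : Module k carrier]
  [module : Module B carrier]
  [isScalarTower : IsScalarTower k B carrier]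
  [comodule : RightComodule k H carrier]
  coact_smul : ∀ (b : B) (x : carrier), coact k H (b • x) = b • coact k H x

attribute [instance] BComod.addCommGroup BComod.moduleBase BComod.module BComod.isScalarTower
  BComod.comodule

namespace BComod

variable {k H B}

/-- The `k`-module of left `B`-linear right `H`-colinear maps. -/
def colinear (X Y : BComod k H B) : Submodule k (X.carrier →ₗ[B] Y.carrier) where
  carrier := {f | ∀ x, coact k H (f x) = (f.restrictScalars k).rTensor H (coact k H x)}
  zero_mem' x := by
    have : (0 : X.carrier →ₗ[B] Y.carrier).restrictScalars k = 0 := rfl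
    simp [this]
  add_mem' {f g} hf hg x := by
    have hf := hf x
    have hg := hg x
    simp [LinearMap.restrictScalars_add, LinearMap.rTensor_add, hf, hg]
  smul_mem' c f hf x := by
    have hf := hf x
    simp [LinearMap.restrictScalars_smul, LinearMap.rTensor_smul, hf]

instance : CategoryTheory.Category (BComod k H B) where
  Hom X Y := colinear X Y
  id X := ⟨LinearMap.id, fun x => by
    change coact k H x = LinearMap.rTensor H LinearMap.id (coact k H x)
    simp⟩
  comp {X Y Z} f g := ⟨g.1 ∘ₗ f.1, fun x => by
    have hf : ∀ x, _ = _ := f.2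
    have hg : ∀ x, _ = _ := g.2
    change coact k H (g.1 (f.1 x)) =
      LinearMap.rTensor H (g.1.restrictScalars k ∘ₗ f.1.restrictScalars k) (coact k H x)
    rw [hg, hf, LinearMap.rTensor_comp, LinearMap.comp_apply]⟩

instance : CategoryTheory.Preadditive (BComod k H B) where
  homGroup X Y := inferInstanceAs (AddCommGroup (colinear X Y))
  add_comp _ _ _ f f' g := Subtype.ext (LinearMap.comp_add f.1 f'.1 g.1)
  comp_add _ _ _ f g g' := Subtype.ext (LinearMap.add_comp f.1 g'.1 g.1)

instance : CategoryTheory.Linear k (BComod k H B) where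
  homModule X Y := inferInstanceAs (Module k (colinear X Y))
  smul_comp _ _ _ c f g := Subtype.ext <| LinearMap.ext fun x =>
    LinearMap.map_smul_of_tower g.1 c (f.1 x)
  comp_smul _ _ _ _ _ _ := rfl

end BComod

variable {B} (M : Type u) [AddCommGroup M] [Module k M] [Module B M] [IsScalarTower k B M]

/-- The coaction `m ⊗ h ↦ m ⊗ h₁ ⊗ h₂` on `M ⊗ H`. -/
instance cofreeComodule : RightComodule k H (M ⊗[k] H) where
  coact := (TensorProduct.assoc k M H H).symm.toLinearMap ∘ₗ Coalgebra.comul.lTensor M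
  coassoc := by
    refine TensorProduct.ext' fun m h => ?_
    have h0 := congrArg (fun z => (TensorProduct.assoc k M H (H ⊗[k] H)).symm (m ⊗ₜ z))
      (Coalgebra.coassoc_apply (R := k) h)
    simp only [LinearMap.comp_apply, LinearEquiv.coe_coe, LinearMap.lTensor_tmul] at h0 ⊢
    refine (Eq.trans ?_ h0).trans ?_
    · generalize (Coalgebra.comul (R := k) h : H ⊗[k] H) = D
      induction D with
      | zero => simp
      | add a b ha hb => simp only [map_add, TensorProduct.tmul_add, ha, hb]
      | tmul a b =>
        simp only [TensorProduct.assoc_symm_tmul, LinearMap.rTensor_tmul, LinearMap.comp_apply,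
          LinearEquiv.coe_coe, LinearMap.lTensor_tmul]
        generalize (Coalgebra.comul (R := k) a : H ⊗[k] H) = D
        induction D with
        | zero => simp
        | add a b ha hb =>
          simp only [map_add, TensorProduct.tmul_add, TensorProduct.add_tmul, ha, hb]
        | tmul a b => rfl
    · generalize (Coalgebra.comul (R := k) h : H ⊗[k] H) = D
      induction D with
      | zero => simp
      | add a b ha hb => simp only [map_add, TensorProduct.tmul_add, ha, hb]
      | tmul a b => rfl
  lTensor_counit x := by
    induction x with
    | zero => simp
    | add a b ha hb => simp only [map_add, TensorProduct.add_tmul, ha, hb]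
    | tmul m h =>
      have h0 := congrArg (fun z => (TensorProduct.assoc k M H k).symm (m ⊗ₜ z))
        (Coalgebra.lTensor_counit_comul (R := k) h)
      refine Eq.trans ?_ h0
      simp only [LinearMap.comp_apply, LinearEquiv.coe_coe, LinearMap.lTensor_tmul]
      generalize (Coalgebra.comul (R := k) h : H ⊗[k] H) = D
      induction D with
      | zero => simp
      | add a b ha hb => simp only [map_add, TensorProduct.tmul_add, ha, hb]
      | tmul a b => rfl

/-- The object `M ⊗ H`, with `b(m ⊗ h) = bm ⊗ h` and `ρ(m ⊗ h) = m ⊗ h₁ ⊗ h₂`. -/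
def cofreeObj : BComod k H B where
  carrier := M ⊗[k] H
  coact_smul b x := by
    induction x with
    | zero => simp
    | add x y hx hy => simp only [smul_add, map_add, hx, hy]
    | tmul m h =>
      rw [TensorProduct.smul_tmul']
      change (TensorProduct.assoc k M H H).symm ((b • m) ⊗ₜ Coalgebra.comul h) =
        b • (TensorProduct.assoc k M H H).symm (m ⊗ₜ Coalgebra.comul h)
      generalize (Coalgebra.comul (R := k) h : H ⊗[k] H) = D
      induction D with
      | zero => simp
      | add x y hx hy => simp only [TensorProduct.tmul_add, smul_add, map_add, hx, hy]
      | tmul a c => rfl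

end RelativeModules

section Main

variable (k : Type v) (H A : Type u) [CommRing k] [Ring H] [HopfAlgebra k H] [Ring A] [Algebra k A]
  [RightComoduleAlgebra k H A] (M : Type u) [AddCommGroup M] [Module k M]
  [Module (coinvariants k H A) M] [IsScalarTower k (coinvariants k H A) M]

theorem inducedCoact_smul (b : coinvariants k H A) (x : RelTensor (coinvariants k H A) M) :
    coact k H (b • x) = b • coact k H x := by
  have hb : coact k H (b : A) = (b : A) ⊗ₜ[k] (1 : H) := b.2
  change coact k H ((b : A) • x) = _
  rw [LeftRightHopfModule.coact_smul, hb]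
  generalize (coact k H x : RelTensor (coinvariants k H A) M ⊗[k] H) = z
  induction z with
  | zero => rw [map_zero, smul_zero]
  | add x y hx hy => rw [map_add, smul_add, hx, hy]
  | tmul p q => rw [diagAct_tmul, one_mul]; rfl

/-- The object `A ⊗_B M`, with `b(a ⊗_B m) = ba ⊗_B m` and `ρ(a ⊗_B m) = (a₀ ⊗_B m) ⊗ a₁`. -/
def inducedObj : BComod k H (coinvariants k H A) where
  carrier := RelTensor (coinvariants k H A) M
  coact_smul := inducedCoact_smul k H A M

/-- The objects `M ⊗ H` (label `1`) and `A ⊗_B M` (label `2`) of `_B M^H`. -/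
def objFamily : Obj → BComod k H (coinvariants k H A)
  | .one => cofreeObj k H M
  | .two => inducedObj k H A M

/-- The full subcategory of `_B M^H` on the two objects `M ⊗ H` and `A ⊗_B M`. -/
abbrev TwoObjSubcat : Type := CategoryTheory.InducedCategory _ (objFamily k H A M)

/-- The right `H`-comodule algebra `END_A(A ⊗_B M)^op`. -/
abbrev EndOpInduced : Subalgebra k (Module.End A (RelTensor (coinvariants k H A) M))ᵐᵒᵖ :=
  RatEndOp k H A (RelTensor (coinvariants k H A) M)

end Main

open CategoryTheory Opposite in
/-- A duality (contravariant isomorphism) between `k`-linear categories: a contravariant functor,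
`k`-linear on morphisms, with a strict two-sided inverse. -/
structure LinearDuality (k : Type*) [CommRing k] (C D : Type*) [Category C] [Category D]
    [Preadditive C] [Preadditive D] [Linear k C] [Linear k D] where
  functor : Cᵒᵖ ⥤ D
  inverse : D ⥤ Cᵒᵖ
  functor_comp_inverse : functor ⋙ inverse = 𝟭 Cᵒᵖ
  inverse_comp_functor : inverse ⋙ functor = 𝟭 D
  map_add : ∀ {X Y : C} (f g : X ⟶ Y), functor.map (f + g).op = functor.map f.op + functor.map g.op
  map_smul : ∀ {X Y : C} (c : k) (f : X ⟶ Y), functor.map (c • f).op = c • functor.map f.op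

end HopfGalois

end

/-! Write P = A ⊗_B M, X_1 = M ⊗ H and X_2 = A ⊗_B M. Everything takes place inside the cofree
comodule P ⊗ H. Both X_j embed in it, B-linearly and colinearly, by `emb`: X_1 through m ⊗ h ↦ (1
⊗_B m) ⊗ h, and X_2 through its coaction. In both cases P ⊗ H is the A-module induced from the
embedded X_j: for X_1 this is associativity of the tensor product (`bijective_cofreeCan`), for X_2
it is the Galois condition with coefficients in M (`bijective_inducedCan`).

A k-linear t : H → End_A(P)^op is the same as an A-linear map P ⊗ H → P (`evalMap`), and by
cofreeness the same as an A-linear colinear endomorphism `hat t` of P ⊗ H, namely p ⊗ h ↦ t(h₁)(p) ⊗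
h₂. Because of the opposite ring, convolution becomes composition in reverse order (`hat_conv`). A
colinear B-linear map X_j → X_i, composed with X_i → P ⊗ H → P (the second map applying the counit),
extends uniquely to an A-linear map P ⊗ H → P, so it is the restriction of exactly one `hat t`.
Conversely, `hat t` gives a map X_j → X_i exactly when it carries the embedded X_j into the embedded
X_i.

It remains to see that this condition on t is the one defining the morphisms i → j of C_E
(`isConvHom_iff_hat_emb`). Put R_1 = L_1 = ηε, R_2 = id, L_2 = S, so that R_j * L_j = ηε. Then: (a)
the four defining conditions are the single formula ρ(t(h)) = t(h₂) ⊗ L_j(h₁)R_i(h₃); (b) X_j is cut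
out of P ⊗ H by the equation p₀ ⊗ p₁ ⊗ h = p ⊗ R_j(h₁) ⊗ h₂ (`mem_range_emb_iff`). For j = 1 this
says that M is the module of coinvariants of P, which is faithfully flat descent (`exact_unit`),
tensored with the flat module H; (c) on X_j the factor R_j provided by (b) cancels L_j, so
membership of the image in X_i becomes formula (a) evaluated on X_j. Both sides of (a) are
compatible with the action of A, and X_j generates P ⊗ H over A, so (a) then holds everywhere
(`hat_emb_mem_range_iff`). In particular each t(h) is automatically rational. -/

noncomputable section

set_option linter.unusedSectionVars false

namespace HopfGalois

open RightComodule (coact)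
open WithConv (toConv)

/-! ### Universal property of A ⊗_B N. -/

section RelTensorLift

variable {k : Type v} {A : Type u} [CommRing k] [Ring A] [Algebra k A] (B : Subalgebra k A)
variable {N Q : Type u} [AddCommGroup N] [Module k N] [Module B N]
  [IsScalarTower k B N] [AddCommGroup Q] [Module k Q] [Module A Q] [IsScalarTower k A Q]

/-- The `A`-linear map `A ⊗_B N → Q`, `a ⊗_B n ↦ a g(n)`, induced by a `B`-linear map `g`. -/
def RelTensor.lift (g : N →ₗ[k] Q) (hg : ∀ (b : B) (n : N), g (b • n) = (b : A) • g n) :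
    RelTensor B N →ₗ[A] Q :=
  Submodule.liftQ (balanced B N) (TensorProduct.AlgebraTensorModule.lift
    (LinearMap.toSpanSingleton A (N →ₗ[k] Q) g)) <| by
      rw [balanced, Submodule.span_le]
      rintro _ ⟨a, b, n, rfl⟩
      simp [hg, mul_smul]

@[simp] theorem RelTensor.lift_tmul (g : N →ₗ[k] Q)
    (hg : ∀ (b : B) (n : N), g (b • n) = (b : A) • g n) (a : A) (n : N) :
    RelTensor.lift B g hg (RelTensor.tmul B a n) = a • g n := rfl

theorem RelTensor.hom_ext {f g : RelTensor B N →ₗ[A] Q}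
    (h : ∀ n, f (RelTensor.tmul B 1 n) = g (RelTensor.tmul B 1 n)) : f = g := by
  ext x
  induction x using RelTensor.induction_on with
  | add x y hx hy => rw [map_add, map_add, hx, hy]
  | tmul a n => rw [← mul_one a, ← RelTensor.smul_tmul, map_smul, map_smul, h]

variable (N) in
/-- The map `N → A ⊗_B N`, `n ↦ 1 ⊗_B n`. -/
def RelTensor.unit : N →ₗ[k] RelTensor B N :=
  (RelTensor.proj B N).restrictScalars k ∘ₗ TensorProduct.mk k A N 1

@[simp] theorem RelTensor.unit_apply (n : N) : RelTensor.unit B N n = RelTensor.tmul B 1 n := rfl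

theorem RelTensor.smul_unit (a : A) (n : N) :
    a • RelTensor.unit B N n = RelTensor.tmul B a n := by
  rw [unit_apply, smul_tmul, mul_one]

theorem RelTensor.unit_smul (b : B) (n : N) :
    RelTensor.unit B N (b • n) = (b : A) • RelTensor.unit B N n := by
  rw [smul_unit, unit_apply, tmul_smul, one_mul]

end RelTensorLift

/-! ### P ⊗ H is induced from M ⊗ H and from A ⊗_B M. -/

section CanonicalMaps

variable (k : Type v) (H A : Type u) [CommRing k] [Ring H] [HopfAlgebra k H] [Ring A] [Algebra k A]
  [RightComoduleAlgebra k H A] (M : Type u) [AddCommGroup M] [Module k M]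
  [Module (coinvariants k H A) M] [IsScalarTower k (coinvariants k H A) M]

/-- The `A`-linear map `(A ⊗_B M) ⊗ H → Q` with `(a ⊗_B m) ⊗ h ↦ a g(m)(h)`. -/
def liftTensor {Q : Type u} [AddCommGroup Q] [Module k Q] [Module A Q] [IsScalarTower k A Q]
    (g : M →ₗ[k] H →ₗ[k] Q)
    (hg : ∀ (b : coinvariants k H A) (m : M), g (b • m) = (b : A) • g m) :
    RelTensor (coinvariants k H A) M ⊗[k] H →ₗ[A] Q :=
  TensorProduct.AlgebraTensorModule.lift (RelTensor.lift _ g hg)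

@[simp] theorem liftTensor_tmul {Q : Type u} [AddCommGroup Q] [Module k Q] [Module A Q]
    [IsScalarTower k A Q] (g : M →ₗ[k] H →ₗ[k] Q)
    (hg : ∀ (b : coinvariants k H A) (m : M), g (b • m) = (b : A) • g m) (a : A) (m : M) (h : H) :
    liftTensor k H A M g hg (RelTensor.tmul _ a m ⊗ₜ h) = a • g m h := rfl

variable {k H A M} in
theorem tensor_hom_ext {Q : Type u} [AddCommGroup Q] [Module k Q] [Module A Q]
    [IsScalarTower k A Q] {f g : RelTensor (coinvariants k H A) M ⊗[k] H →ₗ[A] Q}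
    (hfg : ∀ (m : M) (h : H), f (RelTensor.tmul _ 1 m ⊗ₜ h) = g (RelTensor.tmul _ 1 m ⊗ₜ h)) :
    f = g := by
  refine TensorProduct.AlgebraTensorModule.curry_injective (RelTensor.hom_ext _ fun m => ?_)
  exact LinearMap.ext fun h => hfg m h

theorem rTensor_unit_smul (b : coinvariants k H A) (x : M ⊗[k] H) :
    (RelTensor.unit (coinvariants k H A) M).rTensor H (b • x) =
      (b : A) • (RelTensor.unit (coinvariants k H A) M).rTensor H x := by
  induction x with
  | zero => simp
  | add x y hx hy => simp only [smul_add, map_add, hx, hy]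
  | tmul m h =>
    rw [TensorProduct.smul_tmul', LinearMap.rTensor_tmul, RelTensor.unit_smul,
      LinearMap.rTensor_tmul, TensorProduct.smul_tmul']

/-- The map `A ⊗_B (M ⊗ H) → (A ⊗_B M) ⊗ H`, `a ⊗_B (m ⊗ h) ↦ (a ⊗_B m) ⊗ h`. -/
def cofreeCan : RelTensor (coinvariants k H A) (M ⊗[k] H) →ₗ[A]
    RelTensor (coinvariants k H A) M ⊗[k] H :=
  RelTensor.lift _ ((RelTensor.unit (coinvariants k H A) M).rTensor H) (rTensor_unit_smul k H A M)

/-- The map `A ⊗_B (A ⊗_B M) → (A ⊗_B M) ⊗ H`, `a ⊗_B p ↦ a p₀ ⊗ p₁`. -/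
def inducedCan : RelTensor (coinvariants k H A) (RelTensor (coinvariants k H A) M) →ₗ[A]
    RelTensor (coinvariants k H A) M ⊗[k] H :=
  RelTensor.lift _ (coact k H) (inducedCoact_smul k H A M)

/-- Associativity of the tensor product; the inverse sends (a ⊗_B m) ⊗ h to a ⊗_B (m ⊗ h). -/
theorem bijective_cofreeCan : Function.Bijective (cofreeCan k H A M) := by
  let g : M →ₗ[k] H →ₗ[k] RelTensor (coinvariants k H A) (M ⊗[k] H) :=
    (TensorProduct.mk k M H).compr₂ (RelTensor.unit (coinvariants k H A) (M ⊗[k] H))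
  let inv := liftTensor k H A M g fun b m => LinearMap.ext fun h => by
    change RelTensor.unit (coinvariants k H A) (M ⊗[k] H) ((b • m) ⊗ₜ[k] h) =
      (b : A) • RelTensor.unit (coinvariants k H A) (M ⊗[k] H) (m ⊗ₜ[k] h)
    rw [← TensorProduct.smul_tmul', RelTensor.unit_smul]
  have h1 : inv ∘ₗ cofreeCan k H A M = LinearMap.id := RelTensor.hom_ext _ fun x => by
    rw [LinearMap.comp_apply, cofreeCan, RelTensor.lift_tmul, one_smul, LinearMap.id_apply,
      ← RelTensor.unit_apply]
    induction x with
    | zero => simp only [map_zero]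
    | add x y hx hy => simp only [map_add, hx, hy]
    | tmul m h => exact one_smul A (g m h)
  have h2 : cofreeCan k H A M ∘ₗ inv = LinearMap.id := tensor_hom_ext fun m h => by
    rw [LinearMap.comp_apply, liftTensor_tmul, one_smul]
    exact one_smul A (RelTensor.tmul (coinvariants k H A) 1 m ⊗ₜ[k] h)
  exact Function.bijective_iff_has_inverse.2
    ⟨inv, LinearMap.congr_fun h1, LinearMap.congr_fun h2⟩

/-- The `B`-linear map `A → A ⊗_B M`, `a ↦ a ⊗_B m`. -/
def tmulLin (m : M) : A →ₗ[coinvariants k H A] RelTensor (coinvariants k H A) M where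
  toFun a := RelTensor.tmul _ a m
  map_add' a a' := map_add (tmulHom k H A M m) a a'
  map_smul' _ _ := rfl

/-- The `B`-linear map `A → A`, `a ↦ ab`. -/
def mulRightLin (b : coinvariants k H A) : A →ₗ[coinvariants k H A] A where
  toFun a := a * b
  map_add' a a' := add_mul a a' b
  map_smul' c a := mul_assoc (c : A) a b

/-- Coinvariance of b gives ρ(a'b) = ρ(a')(b ⊗ 1). This makes can⁻¹(1 ⊗ h) commute with B, on which
the inverse of `inducedCan` depends. -/
theorem can_map_mulRightLin (b : coinvariants k H A) (y : RelTensor (coinvariants k H A) A) :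
    can k H A (RelTensor.map _ (mulRightLin k H A b) y) =
      can k H A y * ((b : A) ⊗ₜ[k] (1 : H)) := by
  have hb : coact k H (b : A) = (b : A) ⊗ₜ[k] (1 : H) := b.2
  induction y using RelTensor.induction_on with
  | add x y hx hy => simp only [map_add, add_mul, hx, hy]
  | tmul a a' =>
    rw [RelTensor.map_tmul, can_tmul, can_tmul]
    change _ * coact k H (a' * (b : A)) = _
    rw [RightComoduleAlgebra.coact_mul, hb, mul_assoc]

theorem map_tmulLin_smul (b : coinvariants k H A) (m : M)
    (y : RelTensor (coinvariants k H A) A) :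
    RelTensor.map _ (tmulLin k H A M (b • m)) y =
      RelTensor.map _ (tmulLin k H A M m) (RelTensor.map _ (mulRightLin k H A b) y) := by
  induction y using RelTensor.induction_on with
  | add x y hx hy => simp only [map_add, hx, hy]
  | tmul a a' =>
    simp only [RelTensor.map_tmul]
    congr 1
    exact RelTensor.tmul_smul _ a' b m

/-- For fixed m, `inducedCan` is `can` with m carried along, so inverting `can` inverts it one m at
a time. -/
theorem inducedCan_map_tmulLin (m : M) (y : RelTensor (coinvariants k H A) A) :
    inducedCan k H A M (RelTensor.map _ (tmulLin k H A M m) y) =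
      (tmulHom k H A M m).rTensor H (can k H A y) := by
  induction y using RelTensor.induction_on with
  | add x y hx hy => simp only [map_add, hx, hy]
  | tmul a a' =>
    rw [RelTensor.map_tmul, can_tmul, inducedCan, RelTensor.lift_tmul]
    change a • inducedCoact k H A M (RelTensor.tmul _ a' m) = _
    rw [inducedCoact_tmul]
    generalize (coact k H a' : A ⊗[k] H) = z
    induction z with
    | zero => simp
    | add x y hx hy => simp only [map_add, smul_add, mul_add, hx, hy]
    | tmul p q =>
      rw [Algebra.TensorProduct.tmul_mul_tmul, one_mul]
      rfl

theorem map_tmulLin_add (m m' : M) (y : RelTensor (coinvariants k H A) A) :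
    RelTensor.map _ (tmulLin k H A M (m + m')) y =
      RelTensor.map _ (tmulLin k H A M m) y + RelTensor.map _ (tmulLin k H A M m') y := by
  refine LinearMap.congr_fun (g := RelTensor.map _ (tmulLin k H A M m) +
    RelTensor.map _ (tmulLin k H A M m')) (RelTensor.hom_ext _ fun a => ?_) y
  simp only [LinearMap.add_apply, RelTensor.map_tmul]
  simp only [tmulLin, LinearMap.coe_mk, AddHom.coe_mk, RelTensor.tmul, TensorProduct.tmul_add,
    map_add]

theorem map_tmulLin_base_smul (c : k) (m : M) (y : RelTensor (coinvariants k H A) A) :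
    RelTensor.map _ (tmulLin k H A M (c • m)) y =
      c • RelTensor.map _ (tmulLin k H A M m) y := by
  -- The scalar c is regarded as an element of B, which reduces the claim to the balancing of A ⊗_B
  -- M.
  rw [← algebraMap_smul (coinvariants k H A) c m, map_tmulLin_smul]
  refine (congrArg _ ?_).trans (LinearMap.map_smul_of_tower _ c y)
  induction y using RelTensor.induction_on with
  | add x y hx hy => simp only [map_add, smul_add, hx, hy]
  | tmul a a' =>
    rw [RelTensor.map_tmul]
    change RelTensor.proj _ _ (a ⊗ₜ (a' * algebraMap k A c)) =
      c • RelTensor.proj _ _ (a ⊗ₜ a')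
    rw [← Algebra.commutes, ← Algebra.smul_def, TensorProduct.tmul_smul,
      LinearMap.map_smul_of_tower]

variable {k H A} in
-- This is `can` tensored over B with M. The inverse is (a ⊗_B m) ⊗ h ↦ Σ a lᵢ ⊗_B (rᵢ ⊗_B m), where
-- Σ lᵢ ⊗_B rᵢ = can⁻¹(1 ⊗ h).
theorem bijective_inducedCan (hGal : IsHopfGalois k H A) :
    Function.Bijective (inducedCan k H A M) := by
  let e : RelTensor (coinvariants k H A) A ≃ₗ[A] A ⊗[k] H := LinearEquiv.ofBijective _ hGal
  have he : ∀ y, can k H A (e.symm y) = y := e.apply_symm_apply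
  let e' : A ⊗[k] H →ₗ[k] RelTensor (coinvariants k H A) A :=
    e.symm.toLinearMap.restrictScalars k
  let g : M →ₗ[k] H →ₗ[k] RelTensor (coinvariants k H A) (RelTensor (coinvariants k H A) M) :=
    LinearMap.mk₂ k (fun m h => RelTensor.map _ (tmulLin k H A M m) (e' (1 ⊗ₜ h)))
    (fun m m' h => map_tmulLin_add k H A M _ _ _)
    (fun c m h => map_tmulLin_base_smul k H A M _ _ _)
    (fun m h h' => by rw [TensorProduct.tmul_add, map_add, map_add])
    (fun c m h => by
      rw [TensorProduct.tmul_smul, map_smul, LinearMap.map_smul_of_tower])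
  -- Balancing over B requires Σ lᵢ ⊗_B rᵢb = Σ b lᵢ ⊗_B rᵢ. Both sides have image b ⊗ h under
  -- `can`, which is injective.
  let inv := liftTensor k H A M g fun b m => LinearMap.ext fun h => by
    change RelTensor.map _ (tmulLin k H A M (b • m)) (e.symm (1 ⊗ₜ h)) =
      (b : A) • RelTensor.map _ (tmulLin k H A M m) (e.symm (1 ⊗ₜ h))
    rw [map_tmulLin_smul, ← map_smul, ← map_smul]
    congr 1
    apply hGal.1
    rw [can_map_mulRightLin, he, he, Algebra.TensorProduct.tmul_mul_tmul,
      TensorProduct.smul_tmul']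
    simp
  have hinv : ∀ (m : M) (z : A ⊗[k] H), inv ((tmulHom k H A M m).rTensor H z) =
      RelTensor.map _ (tmulLin k H A M m) (e.symm z) := by
    intro m z
    induction z with
    | zero => simp
    | add x y hx hy => simp only [map_add, hx, hy]
    | tmul a h =>
      have h1 : a ⊗ₜ[k] h = a • ((1 : A) ⊗ₜ[k] h) := by simp [TensorProduct.smul_tmul']
      refine Eq.trans (b := a • g m h) rfl ?_
      rw [h1, map_smul, map_smul]
      rfl
  have h1 : inv ∘ₗ inducedCan k H A M = LinearMap.id := RelTensor.hom_ext _ fun p => by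
    rw [LinearMap.comp_apply, LinearMap.id_apply]
    induction p using RelTensor.induction_on with
    | add x y hx hy =>
      simp only [← RelTensor.unit_apply] at hx hy ⊢
      simp only [map_add, hx, hy]
    | tmul a m =>
      change inv (inducedCan k H A M (RelTensor.map _ (tmulLin k H A M m)
        (RelTensor.tmul _ 1 a))) = RelTensor.map _ (tmulLin k H A M m) (RelTensor.tmul _ 1 a)
      rw [inducedCan_map_tmulLin, hinv]
      exact congrArg _ (e.symm_apply_apply _)
  have h2 : inducedCan k H A M ∘ₗ inv = LinearMap.id := tensor_hom_ext fun m h => by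
    rw [LinearMap.comp_apply, LinearMap.id_apply]
    change inducedCan k H A M (inv ((tmulHom k H A M m).rTensor H (1 ⊗ₜ h))) =
      (tmulHom k H A M m).rTensor H (1 ⊗ₜ h)
    rw [hinv, inducedCan_map_tmulLin, he]
  exact Function.bijective_iff_has_inverse.2
    ⟨inv, LinearMap.congr_fun h1, LinearMap.congr_fun h2⟩

end CanonicalMaps

/-! ### Faithfully flat descent: M is the module of coinvariants of A ⊗_B M. -/

section Descent

variable (k : Type v) (H A : Type u) [CommRing k] [Ring H] [HopfAlgebra k H] [Ring A] [Algebra k A]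
  [RightComoduleAlgebra k H A] (M : Type u) [AddCommGroup M] [Module k M]
  [Module (coinvariants k H A) M] [IsScalarTower k (coinvariants k H A) M]

/-- The `B`-linear map `M → A ⊗_B M`, `m ↦ 1 ⊗_B m`. -/
def unitLin : M →ₗ[coinvariants k H A] RelTensor (coinvariants k H A) M where
  __ := RelTensor.unit (coinvariants k H A) M
  map_smul' := RelTensor.unit_smul (coinvariants k H A)

/-- The `B`-linear map `A ⊗_B M → (A ⊗_B M) ⊗ H`, `p ↦ ρ(p) - p ⊗ 1`. -/
def coactSubLin : RelTensor (coinvariants k H A) M →ₗ[coinvariants k H A]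
    RelTensor (coinvariants k H A) M ⊗[k] H where
  __ := coact k H - (TensorProduct.mk k (RelTensor (coinvariants k H A) M) H).flip 1
  map_smul' b p := by
    change coact k H (b • p) - (b • p) ⊗ₜ 1 = b • (coact k H p - p ⊗ₜ 1)
    rw [inducedCoact_smul, smul_sub]
    rfl

theorem coact_unit (m : M) : coact k H (RelTensor.unit (coinvariants k H A) M m) =
    RelTensor.unit (coinvariants k H A) M m ⊗ₜ[k] (1 : H) := by
  change inducedCoact k H A M (RelTensor.tmul _ 1 m) = _
  rw [inducedCoact_tmul, RightComoduleAlgebra.coact_one]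
  rfl

/-- The `A`-linear action map `A ⊗_B Q → Q`. -/
def actMap (Q : Type u) [AddCommGroup Q] [Module k Q] [Module A Q] [IsScalarTower k A Q] :
    RelTensor (coinvariants k H A) Q →ₗ[A] Q :=
  RelTensor.lift _ LinearMap.id fun _ _ => rfl

/-- After applying A ⊗_B -, the unit M → A ⊗_B M is split by the action of A. -/
theorem actMap_map_unitLin (y : RelTensor (coinvariants k H A) M) :
    actMap k H A _ (RelTensor.map _ (unitLin k H A M) y) = y := by
  refine LinearMap.congr_fun (f := actMap k H A _ ∘ₗ RelTensor.map _ (unitLin k H A M))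
    (g := LinearMap.id) (RelTensor.hom_ext _ fun m => ?_) y
  exact one_smul A (RelTensor.unit (coinvariants k H A) M m)

theorem inducedCan_map_unitLin (y : RelTensor (coinvariants k H A) M) :
    inducedCan k H A M (RelTensor.map _ (unitLin k H A M) y) = y ⊗ₜ 1 := by
  refine LinearMap.congr_fun (f := inducedCan k H A M ∘ₗ RelTensor.map _ (unitLin k H A M))
    (g := (TensorProduct.AlgebraTensorModule.mk k A _ H).flip 1)
    (RelTensor.hom_ext _ fun m => ?_) y
  exact (one_smul A _).trans (coact_unit k H A M m)

/-- If A ⊗_B (ρ - (- ⊗ 1)) kills x, this identity forces `inducedCan` of x to have the form y ⊗ 1,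
with y the image of x under the action. -/
theorem actMap_map_coactSubLin
    (x : RelTensor (coinvariants k H A) (RelTensor (coinvariants k H A) M)) :
    actMap k H A _ (RelTensor.map _ (coactSubLin k H A M) x) =
      inducedCan k H A M x - actMap k H A _ x ⊗ₜ 1 := by
  refine LinearMap.congr_fun
    (f := actMap k H A _ ∘ₗ RelTensor.map _ (coactSubLin k H A M))
    (g := inducedCan k H A M - (TensorProduct.AlgebraTensorModule.mk k A _ H).flip 1 ∘ₗ
      actMap k H A _) (RelTensor.hom_ext _ fun p => ?_) x
  change (1 : A) • (coact k H p - p ⊗ₜ 1) = (1 : A) • coact k H p - ((1 : A) • p) ⊗ₜ 1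
  simp only [one_smul]

variable {k H A} in
-- The unit becomes a split injection after A ⊗_B -, and A ⊗_B - reflects exactness.
theorem injective_unit (hff : IsRightFaithfullyFlat (coinvariants k H A)) :
    Function.Injective (RelTensor.unit (coinvariants k H A) M) := by
  -- Injectivity is expressed as exactness of 0 → M → A ⊗_B M, to which the faithful flatness
  -- hypothesis applies.
  let z : PUnit.{u + 1} →ₗ[coinvariants k H A] M := 0
  have h : Function.Exact z (unitLin k H A M) := by
    refine (hff _ _ _ z (unitLin k H A M)).1 fun y => ⟨fun hy => ⟨0, ?_⟩, ?_⟩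
    · rw [← actMap_map_unitLin k H A M y, hy, map_zero, map_zero]
    · rintro ⟨w, rfl⟩
      induction w using RelTensor.induction_on with
      | add x y hx hy => rw [map_add, map_add, hx, hy, add_zero]
      | tmul a w =>
        rw [RelTensor.map_tmul, RelTensor.map_tmul]
        simp [RelTensor.tmul, z]
  refine (injective_iff_map_eq_zero _).2 fun m hm => ?_
  obtain ⟨w, hw⟩ := (h m).1 hm
  exact hw.symm

variable {k H A} in
-- Exactness is reflected by A ⊗_B -. After this functor, an x in the kernel satisfies inducedCan(x)
-- = y ⊗ 1, where y is the image of x under the action. The image of y under A ⊗_B (unit) has the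
-- same value under `inducedCan`, so it equals x.
theorem exact_unit (hGal : IsHopfGalois k H A)
    (hff : IsRightFaithfullyFlat (coinvariants k H A)) :
    Function.Exact (RelTensor.unit (coinvariants k H A) M)
      (coact k H (V := RelTensor (coinvariants k H A) M) -
        (TensorProduct.mk k (RelTensor (coinvariants k H A) M) H).flip 1) := by
  refine (hff _ _ _ (unitLin k H A M) (coactSubLin k H A M)).1 fun x => ⟨fun hx => ?_, ?_⟩
  · refine ⟨actMap k H A _ x, (bijective_inducedCan M hGal).1 ?_⟩
    rw [inducedCan_map_unitLin]
    have h := actMap_map_coactSubLin k H A M x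
    rw [hx, map_zero] at h
    exact (sub_eq_zero.1 h.symm).symm
  · rintro ⟨y, rfl⟩
    induction y using RelTensor.induction_on with
    | add x y hx hy => rw [map_add, map_add, hx, hy, add_zero]
    | tmul a m =>
      rw [RelTensor.map_tmul, RelTensor.map_tmul]
      have h : coactSubLin k H A M (unitLin k H A M m) = 0 := sub_eq_zero.2 (coact_unit k H A M m)
      rw [h]
      simp [RelTensor.tmul]

end Descent

/-! ### The two objects as subobjects of P ⊗ H. -/

section Embeddings

variable (k : Type v) (H A : Type u) [CommRing k] [Ring H] [HopfAlgebra k H] [Ring A] [Algebra k A]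
  [RightComoduleAlgebra k H A] (M : Type u) [AddCommGroup M] [Module k M]
  [Module (coinvariants k H A) M] [IsScalarTower k (coinvariants k H A) M]

/-- The underlying module of `M ⊗ H` (label `1`) or of `A ⊗_B M` (label `2`). -/
abbrev Carrier (j : Obj) : Type u := (objFamily k H A M j).carrier

/-- The embeddings `m ⊗ h ↦ (1 ⊗_B m) ⊗ h` and `ρ` of `M ⊗ H` and of `A ⊗_B M` into
`(A ⊗_B M) ⊗ H`. -/
def emb : (j : Obj) → Carrier k H A M j →ₗ[k] RelTensor (coinvariants k H A) M ⊗[k] H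
  | .one => (RelTensor.unit (coinvariants k H A) M).rTensor H
  | .two => coact k H (V := RelTensor (coinvariants k H A) M)

theorem emb_smul (j : Obj) (b : coinvariants k H A) (x : Carrier k H A M j) :
    emb k H A M j (b • x) = (b : A) • emb k H A M j x := by
  cases j
  · exact rTensor_unit_smul k H A M b x
  · exact inducedCoact_smul k H A M b x

variable {k H A} in
-- For M ⊗ H, the unit is injective and H is flat; for A ⊗_B M, the counit is a retraction of the
-- coaction.
theorem emb_injective [BijectiveAntipode k H] [Module.Projective k H] (hff : IsRightFaithfullyFlat (coinvariants k H A))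
    (j : Obj) : Function.Injective (emb k H A M j) := by
  cases j
  · exact Module.Flat.rTensor_preserves_injective_linearMap (M := H) _ (injective_unit M hff)
  · exact Function.LeftInverse.injective
      (contract_counit_coact (H := H) (V := RelTensor (coinvariants k H A) M))

/-- Colinearity of the embeddings into the cofree comodule P ⊗ H; for A ⊗_B M this is
coassociativity. -/
theorem rTensor_emb_coact (j : Obj) (x : Carrier k H A M j) :
    (emb k H A M j).rTensor H (coact k H x) = coact k H (emb k H A M j x) := by
  cases j
  · change M ⊗[k] H at x
    change ((RelTensor.unit (coinvariants k H A) M).rTensor H).rTensor H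
      ((TensorProduct.assoc k M H H).symm (Coalgebra.comul.lTensor M x)) =
        (TensorProduct.assoc k _ H H).symm (Coalgebra.comul.lTensor _
          ((RelTensor.unit (coinvariants k H A) M).rTensor H x))
    induction x with
    | zero => simp only [map_zero]
    | add x y hx hy => simp only [map_add, hx, hy]
    | tmul m h =>
      simp only [LinearMap.lTensor_tmul, LinearMap.rTensor_tmul]
      generalize (Coalgebra.comul (R := k) h : H ⊗[k] H) = D
      induction D with
      | zero => simp
      | add x y hx hy => simp only [map_add, TensorProduct.tmul_add, hx, hy]
      | tmul a c => rfl
  · exact (LinearEquiv.eq_symm_apply _).2 (LinearMap.congr_fun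
      (RightComodule.coassoc (k := k) (H := H) (V := RelTensor (coinvariants k H A) M)) x)

variable {k H A M} in
-- Surjectivity of the canonical maps: either embedded object generates P ⊗ H over A, so additive
-- and A-compatible statements need checking only there.
theorem emb_induction (hGal : IsHopfGalois k H A) (j : Obj)
    {motive : RelTensor (coinvariants k H A) M ⊗[k] H → Prop}
    (smul : ∀ (a : A) (x : Carrier k H A M j), motive (a • emb k H A M j x))
    (add : ∀ x y, motive x → motive y → motive (x + y))
    (z : RelTensor (coinvariants k H A) M ⊗[k] H) : motive z := by
  cases j
  · obtain ⟨y, rfl⟩ := (bijective_cofreeCan k H A M).2 z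
    induction y using RelTensor.induction_on with
    | add x y hx hy => rw [map_add]; exact add _ _ hx hy
    | tmul a x => exact smul a x
  · obtain ⟨y, rfl⟩ := (bijective_inducedCan M hGal).2 z
    induction y using RelTensor.induction_on with
    | add x y hx hy => rw [map_add]; exact add _ _ hx hy
    | tmul a x => exact smul a x

/-- The universal property of A ⊗_B X, transported along the isomorphism A ⊗_B X ≅ Y. -/
theorem exists_extension_of_bijective {B : Subalgebra k A} {X Y Q : Type u} [AddCommGroup X]
    [Module k X] [Module B X] [IsScalarTower k B X] [AddCommGroup Y] [Module k Y] [Module A Y]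
    [IsScalarTower k A Y] [AddCommGroup Q] [Module k Q] [Module A Q] [IsScalarTower k A Q]
    (e : X →ₗ[k] Y) (he : ∀ (b : B) (x : X), e (b • x) = (b : A) • e x)
    (hbij : Function.Bijective (RelTensor.lift B e he))
    (g : X →ₗ[k] Q) (hg : ∀ (b : B) (x : X), g (b • x) = (b : A) • g x) :
    ∃ F : Y →ₗ[A] Q, ∀ x, F (e x) = g x := by
  let φ := LinearEquiv.ofBijective _ hbij
  refine ⟨RelTensor.lift B g hg ∘ₗ φ.symm.toLinearMap, fun x => ?_⟩
  have h : e x = φ (RelTensor.tmul B 1 x) := (one_smul A (e x)).symm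
  rw [h, LinearMap.comp_apply, LinearEquiv.coe_coe, φ.symm_apply_apply, RelTensor.lift_tmul,
    one_smul]

variable {k H A M} in
theorem exists_extension (hGal : IsHopfGalois k H A) (j : Obj) {Q : Type u} [AddCommGroup Q]
    [Module k Q] [Module A Q] [IsScalarTower k A Q] (g : Carrier k H A M j →ₗ[k] Q)
    (hg : ∀ (b : coinvariants k H A) (x : Carrier k H A M j), g (b • x) = (b : A) • g x) :
    ∃ F : RelTensor (coinvariants k H A) M ⊗[k] H →ₗ[A] Q, ∀ x, F (emb k H A M j x) = g x := by
  refine exists_extension_of_bijective k A (emb k H A M j) (emb_smul k H A M j) ?_ g hg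
  cases j
  · exact bijective_cofreeCan k H A M
  · exact bijective_inducedCan M hGal

/-- The maps `R_1 = ηε` and `R_2 = id`. -/
def sourceMap : Obj → H →ₗ[k] H
  | .one => Algebra.linearMap k H ∘ₗ Coalgebra.counit
  | .two => LinearMap.id

/-- The maps `L_1 = ηε` and `L_2 = S`. -/
def targetMap : Obj → H →ₗ[k] H
  | .one => Algebra.linearMap k H ∘ₗ Coalgebra.counit
  | .two => HopfAlgebra.antipode k

/-- The image of `emb` consists of those `p ⊗ h` with `p₀ ⊗ p₁ ⊗ h = p ⊗ R(h₁) ⊗ h₂`. -/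
theorem mem_range_emb_iff [BijectiveAntipode k H] [Module.Projective k H]
    (hGal : IsHopfGalois k H A)
    (hff : IsRightFaithfullyFlat (coinvariants k H A)) (j : Obj)
    (z : RelTensor (coinvariants k H A) M ⊗[k] H) :
    z ∈ LinearMap.range (emb k H A M j) ↔ (coact k H).rTensor H z =
      ((sourceMap k H j).lTensor _).rTensor H (coact k H z) := by
  cases j
  -- The descent sequence stays exact after - ⊗ H. Its second map becomes (ρ ⊗ H) - (- ⊗ 1 ⊗ H), and
  -- R_1 = ηε produces exactly this middle factor 1.
  · have hex := Module.Flat.rTensor_exact (M := H) (exact_unit M hGal hff)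
    refine (hex z).symm.trans ?_
    rw [LinearMap.rTensor_sub, LinearMap.sub_apply, sub_eq_zero]
    refine Eq.congr rfl ?_
    change _ = ((sourceMap k H .one).lTensor _).rTensor H
      ((TensorProduct.assoc k _ H H).symm (Coalgebra.comul.lTensor _ z))
    induction z with
    | zero => simp only [map_zero]
    | add x y hx hy => simp only [map_add, hx, hy]
    | tmul p h =>
      have h1 : ∀ D : H ⊗[k] H, ((sourceMap k H .one).lTensor _).rTensor H
          ((TensorProduct.assoc k _ H H).symm (p ⊗ₜ D)) =
          (p ⊗ₜ[k] (1 : H)) ⊗ₜ[k] TensorProduct.lid k H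
            ((Coalgebra.counit (R := k) (A := H)).rTensor H D) := fun D => by
        induction D with
        | zero => simp
        | add x y hx hy => simp only [map_add, TensorProduct.tmul_add, hx, hy]
        | tmul a c =>
          simp [sourceMap, Algebra.algebraMap_eq_smul_one, TensorProduct.smul_tmul',
            TensorProduct.tmul_smul]
      rw [LinearMap.lTensor_tmul, h1, Coalgebra.rTensor_counit_comul]
      simp
  · have h0 : ∀ w : (RelTensor (coinvariants k H A) M ⊗[k] H) ⊗[k] H,
        ((sourceMap k H .two).lTensor _).rTensor H w = w := fun w => by
      rw [sourceMap, LinearMap.lTensor_id, LinearMap.rTensor_id, LinearMap.id_apply]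
    rw [h0]
    constructor
    · rintro ⟨x, rfl⟩
      exact rTensor_emb_coact k H A M .two x
    · intro h
      -- A preimage under ρ can only be (id ⊗ ε)(z); contracting the last factor of the hypothesis
      -- with ε shows that it is one.
      refine ⟨contract (RelTensor (coinvariants k H A) M) Coalgebra.counit z, ?_⟩
      have h2 := congrArg (contract _ (Coalgebra.counit (R := k) (A := H))) h
      rw [contract_rTensor, contract_counit_coact] at h2
      exact h2

end Embeddings

/-! ### The four coaction conditions as one convolution identity. -/

section ConvolutionInTensor

variable {k : Type v} {H W : Type u} [CommRing k] [Ring H] [HopfAlgebra k H] [Ring W] [Algebra k W]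

variable (W) in
/-- The map `h ↦ 1 ⊗ ψ(h)`. -/
def convRight (ψ : H →ₗ[k] H) : WithConv (H →ₗ[k] W ⊗[k] H) :=
  toConv ((Algebra.TensorProduct.includeRight : H →ₐ[k] W ⊗[k] H).toLinearMap ∘ₗ ψ)

/-- The map `h ↦ t(h₂) ⊗ L(h₁)R(h₃)`. -/
def convTwist (t : H →ₗ[k] W) (i j : Obj) : H →ₗ[k] W ⊗[k] H :=
  (convRight W (targetMap k H j) * (convI t * convRight W (sourceMap k H i))).ofConv

theorem convRight_unit :
    convRight (k := k) (H := H) W (Algebra.linearMap k H ∘ₗ Coalgebra.counit) = 1 := by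
  apply WithConv.ofConv_injective
  ext h
  simp [convRight, LinearMap.convOne_def, Algebra.algebraMap_eq_smul_one,
    TensorProduct.smul_tmul', Algebra.TensorProduct.one_def]

theorem convRight_mul (ψ ψ' : H →ₗ[k] H) :
    convRight W ψ * convRight W ψ' = convRight W (conv ψ ψ') :=
  (congrArg toConv (LinearMap.algHom_comp_convMul_distrib
    (Algebra.TensorProduct.includeRight : H →ₐ[k] W ⊗[k] H) (toConv ψ) (toConv ψ'))).symm

/-- For j = 2 this is the antipode axiom id * S = ηε. It is the reason why the target contributes S
on the left. -/
theorem conv_sourceMap_targetMap (j : Obj) : conv (sourceMap k H j) (targetMap k H j) =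
    Algebra.linearMap k H ∘ₗ Coalgebra.counit := by
  cases j
  · exact congrArg WithConv.ofConv (mul_one (1 : WithConv (H →ₗ[k] H)))
  · exact congrArg WithConv.ofConv LinearMap.id_mul_antipode

/-- The twist is the product L_j * t * R_i, and R_j cancels L_j from the left. -/
theorem convRight_sourceMap_mul_convTwist (t : H →ₗ[k] W) (i j : Obj) :
    convRight W (sourceMap k H j) * toConv (convTwist t i j) =
      convI t * convRight W (sourceMap k H i) := by
  rw [convTwist, WithConv.toConv_ofConv, ← mul_assoc, convRight_mul, conv_sourceMap_targetMap,
    convRight_unit, one_mul]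

/-- An algebra map composed with a convolution product is the product of the composites. Applied to
the inclusion of the rational endomorphisms in all endomorphisms, this lets twists be computed in
the larger algebra. -/
theorem map_convTwist {W' : Type u} [Ring W'] [Algebra k W'] (f : W →ₐ[k] W') (t : H →ₗ[k] W)
    (i j : Obj) (h : H) : Algebra.TensorProduct.map f (AlgHom.id k H) (convTwist t i j h) =
      convTwist (f.toLinearMap ∘ₗ t) i j h := by
  let F := Algebra.TensorProduct.map f (AlgHom.id k H)
  have h1 : ∀ ψ : H →ₗ[k] H, toConv (F.toLinearMap ∘ₗ (convRight W ψ).ofConv) =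
      convRight W' ψ := fun ψ => by
    apply WithConv.ofConv_injective
    ext h
    simp [convRight, F]
  have h2 : toConv (F.toLinearMap ∘ₗ (convI t).ofConv) = convI (f.toLinearMap ∘ₗ t) := by
    apply WithConv.ofConv_injective
    ext h
    simp [convI, F]
  refine LinearMap.congr_fun (f := F.toLinearMap ∘ₗ convTwist t i j) ?_ h
  rw [convTwist, LinearMap.algHom_comp_convMul_distrib, LinearMap.algHom_comp_convMul_distrib,
    h1, WithConv.toConv_ofConv, h1, h2]
  rfl

/-- The uniform description ρ(f(h)) = f(h₂) ⊗ L_j(h₁)R_i(h₃); a factor ηε is a unit for convolution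
and disappears. -/
theorem isConvHom_iff_convTwist [RightComoduleAlgebra k H W] (f : H →ₗ[k] W) (i j : Obj) :
    IsConvHom f i j ↔ ∀ h, coact k H (f h) = convTwist f i j h := by
  have hL : convL k H W j = convRight W (targetMap k H j) := by
    cases j
    · exact convRight_unit.symm
    · rfl
  have hR : convR k H W i = convRight W (sourceMap k H i) := by
    cases i
    · exact convRight_unit.symm
    · rfl
  rw [isConvHom_iff, hL, hR, ← WithConv.ofConv_injective.eq_iff, LinearMap.ext_iff]
  rfl

end ConvolutionInTensor

/-! ### Maps H → End_A(P)^op as colinear endomorphisms of P ⊗ H. -/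

section Evaluation

variable {k : Type v} {H A P : Type u} [CommRing k] [Ring H] [HopfAlgebra k H] [Ring A]
  [Algebra k A] [AddCommGroup P] [Module k P] [Module A P] [IsScalarTower k A P]

/-- The `A`-linear map `P ⊗ H → P`, `p ⊗ h ↦ t(h)(p)`. -/
def evalMap (t : H →ₗ[k] (Module.End A P)ᵐᵒᵖ) : P ⊗[k] H →ₗ[A] P :=
  TensorProduct.AlgebraTensorModule.lift
    { toFun := fun p => ((opToEnd k A P) ∘ₗ t).flip p
      map_add' := fun p q => map_add _ p q
      map_smul' := fun a p => LinearMap.ext fun h => (t h).unop.map_smul a p }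

@[simp] theorem evalMap_tmul (t : H →ₗ[k] (Module.End A P)ᵐᵒᵖ) (p : P) (h : H) :
    evalMap t (p ⊗ₜ h) = (t h).unop p := rfl

theorem exists_evalMap_eq (F : P ⊗[k] H →ₗ[A] P) :
    ∃ t : H →ₗ[k] (Module.End A P)ᵐᵒᵖ, evalMap t = F := by
  refine ⟨{ toFun := fun h => MulOpposite.op
              (F ∘ₗ (TensorProduct.AlgebraTensorModule.mk k A P H).flip h)
            map_add' := fun h h' => ?_
            map_smul' := fun c h => ?_ }, ?_⟩
  · apply MulOpposite.unop_injective
    ext p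
    simp
  · apply MulOpposite.unop_injective
    ext p
    simp
  · ext p h
    rfl

theorem rTensor_smul {Q : Type u} [AddCommGroup Q] [Module k Q] [Module A Q]
    [IsScalarTower k A Q] (F : P →ₗ[A] Q) (a : A) (z : P ⊗[k] H) :
    (F.restrictScalars k).rTensor H (a • z) = a • (F.restrictScalars k).rTensor H z := by
  induction z with
  | zero => simp
  | add x y hx hy => simp only [smul_add, map_add, hx, hy]
  | tmul p h => simp [TensorProduct.smul_tmul']

theorem cofree_coact_smul (a : A) (z : P ⊗[k] H) : coact k H (a • z) = a • coact k H z :=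
  (cofreeObj k H P (B := A)).coact_smul a z

theorem cofree_coact_rTensor {V V' : Type u} [AddCommGroup V] [Module k V] [AddCommGroup V']
    [Module k V'] (f : V →ₗ[k] V') (z : V ⊗[k] H) :
    coact k H (f.rTensor H z) = (f.rTensor H).rTensor H (coact k H z) := by
  change (TensorProduct.assoc k V' H H).symm (Coalgebra.comul.lTensor V' (f.rTensor H z)) =
    (f.rTensor H).rTensor H ((TensorProduct.assoc k V H H).symm (Coalgebra.comul.lTensor V z))
  induction z with
  | zero => simp only [map_zero]
  | add x y hx hy => simp only [map_add, hx, hy]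
  | tmul m h =>
    simp only [LinearMap.lTensor_tmul, LinearMap.rTensor_tmul]
    generalize (Coalgebra.comul (R := k) h : H ⊗[k] H) = D
    induction D with
    | zero => simp
    | add x y hx hy => simp only [map_add, TensorProduct.tmul_add, hx, hy]
    | tmul a c => rfl

/-- The `A`-linear map `P ⊗ H → P ⊗ H`, `p ⊗ h ↦ t(h₁)(p) ⊗ h₂`. -/
def hat (t : H →ₗ[k] (Module.End A P)ᵐᵒᵖ) : P ⊗[k] H →ₗ[A] P ⊗[k] H where
  toFun z := ((evalMap t).restrictScalars k).rTensor H (coact k H z)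
  map_add' x y := by rw [map_add, map_add]
  map_smul' a z := by rw [cofree_coact_smul, rTensor_smul, RingHom.id_apply]

theorem hat_apply (t : H →ₗ[k] (Module.End A P)ᵐᵒᵖ) (z : P ⊗[k] H) :
    hat t z = ((evalMap t).restrictScalars k).rTensor H (coact k H z) := rfl

theorem coassoc_symm (V : Type u) [AddCommGroup V] [Module k V] [RightComodule k H V] (x : V) :
    (coact k H).rTensor H (coact k H x) = coact k H (coact k H x) :=
  (LinearEquiv.eq_symm_apply _).2 (LinearMap.congr_fun
    (RightComodule.coassoc (k := k) (H := H) (V := V)) x)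

theorem coact_hat (t : H →ₗ[k] (Module.End A P)ᵐᵒᵖ) (z : P ⊗[k] H) :
    coact k H (hat t z) = ((hat t).restrictScalars k).rTensor H (coact k H z) := by
  rw [hat_apply, cofree_coact_rTensor, ← coassoc_symm, ← LinearMap.comp_apply,
    ← LinearMap.rTensor_comp]
  rfl

/-- Uniqueness in the universal property of the cofree comodule: colinear maps into P ⊗ H agree once
they agree after applying the counit. -/
theorem hat_eq_of_evalMap {t : H →ₗ[k] (Module.End A P)ᵐᵒᵖ} {F : P ⊗[k] H →ₗ[k] P ⊗[k] H}
    (hF : ∀ z, coact k H (F z) = F.rTensor H (coact k H z)) {s : H →ₗ[k] (Module.End A P)ᵐᵒᵖ}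
    (h : ∀ z, evalMap s z = evalMap t (F z)) (z : P ⊗[k] H) : hat s z = hat t (F z) := by
  rw [hat_apply, hat_apply, hF, ← LinearMap.rTensor_comp_apply]
  congr 2
  exact LinearMap.ext h

/-- Both sides send p ⊗ h to f(h₂)(g(h₁)(p)) ⊗ h₃. The product in the opposite ring applies the left
factor first, which is the source of contravariance. -/
theorem hat_conv (f g : H →ₗ[k] (Module.End A P)ᵐᵒᵖ) (z : P ⊗[k] H) :
    hat (conv g f) z = hat f (hat g z) := by
  refine hat_eq_of_evalMap (F := (hat g).restrictScalars k) (coact_hat g) (fun z => ?_) z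
  induction z with
  | zero => simp only [map_zero]
  | add x y hx hy => simp only [map_add, hx, hy]
  | tmul p h =>
    rw [LinearMap.restrictScalars_apply, hat_apply]
    change MulOpposite.unop (LinearMap.mul' k _ (TensorProduct.map g f (Coalgebra.comul h))) p =
      evalMap f (((evalMap g).restrictScalars k).rTensor H
        ((TensorProduct.assoc k P H H).symm (p ⊗ₜ Coalgebra.comul h)))
    generalize (Coalgebra.comul (R := k) h : H ⊗[k] H) = D
    induction D with
    | zero => simp
    | add x y hx hy =>
      simp only [map_add, TensorProduct.tmul_add, MulOpposite.unop_add, LinearMap.add_apply,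
        hx, hy]
    | tmul a c => rfl

theorem contract_counit_cofree_coact (z : P ⊗[k] H) :
    contract (P ⊗[k] H) (Coalgebra.counit (R := k) (A := H)) (coact k H z) = z := by
  rw [contract, LinearMap.comp_apply, RightComodule.lTensor_counit]
  simp

/-- The counit recovers t from `hat t`. -/
theorem contract_hat (t : H →ₗ[k] (Module.End A P)ᵐᵒᵖ) (z : P ⊗[k] H) :
    contract P (Coalgebra.counit (R := k) (A := H)) (hat t z) = evalMap t z := by
  rw [hat_apply, contract_rTensor, contract_counit_cofree_coact]
  rfl

theorem rTensor_contract_counit (z : P ⊗[k] H) :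
    (contract P (Coalgebra.counit (R := k) (A := H))).rTensor H (coact k H z) = z := by
  have h1 : ∀ D : P ⊗[k] (H ⊗[k] H), (contract P (Coalgebra.counit (R := k) (A := H))).rTensor H
      ((TensorProduct.assoc k P H H).symm D) =
      ((TensorProduct.lid k H).toLinearMap ∘ₗ Coalgebra.counit.rTensor H).lTensor P D := by
    intro D
    refine LinearMap.congr_fun (f := (contract P Coalgebra.counit).rTensor H ∘ₗ
      (TensorProduct.assoc k P H H).symm.toLinearMap) ?_ D
    ext p h h'
    simp [TensorProduct.smul_tmul]
  change (contract P Coalgebra.counit).rTensor H ((TensorProduct.assoc k P H H).symm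
    (Coalgebra.comul.lTensor P z)) = z
  rw [h1, ← LinearMap.comp_apply, ← LinearMap.lTensor_comp]
  -- Here the counit acts on the first leg of Δ, unlike in the comodule axiom for P ⊗ H, where it
  -- acts on the second.
  have h2 : ((TensorProduct.lid k H).toLinearMap ∘ₗ Coalgebra.counit.rTensor H) ∘ₗ
      (Coalgebra.comul (R := k) (A := H)) = LinearMap.id := by
    ext h
    simp
  rw [h2, LinearMap.lTensor_id, LinearMap.id_apply]

theorem hat_counit (z : P ⊗[k] H) :
    hat (A := A) (Algebra.linearMap k (Module.End A P)ᵐᵒᵖ ∘ₗ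
      (Coalgebra.counit (R := k) (A := H))) z = z := by
  have h1 : (evalMap (Algebra.linearMap k (Module.End A P)ᵐᵒᵖ ∘ₗ
      (Coalgebra.counit (R := k) (A := H)))).restrictScalars k =
      contract P (Coalgebra.counit (R := k) (A := H)) := by
    refine TensorProduct.ext' fun p h => ?_
    simp [Algebra.algebraMap_eq_smul_one]
  rw [hat_apply, h1, rTensor_contract_counit]

/-- The map `P ⊗ H ⊗ H → P ⊗ H`, `w ⊗ h ↦ x(h) w`. -/
def actLift (x : H →ₗ[k] (Module.End A P)ᵐᵒᵖ ⊗[k] H) : (P ⊗[k] H) ⊗[k] H →ₗ[k] P ⊗[k] H :=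
  TensorProduct.lift ((ratAct k H A P) ∘ₗ x).flip

@[simp] theorem actLift_tmul (x : H →ₗ[k] (Module.End A P)ᵐᵒᵖ ⊗[k] H) (w : P ⊗[k] H) (h : H) :
    actLift x (w ⊗ₜ h) = ratAct k H A P (x h) w := rfl

/-- The element p ⊗ ψ(h₁) is 1 ⊗ ψ(h₁) acting on p ⊗ 1. Since a product in End_A(P)^op ⊗ H applies
its left factor first, the subsequent action of x(h₂) amounts to a convolution product. -/
theorem actLift_cofree (ψ : H →ₗ[k] H) (x : H →ₗ[k] (Module.End A P)ᵐᵒᵖ ⊗[k] H) (p : P) (h : H) :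
    actLift x ((ψ.lTensor P).rTensor H (coact k H (p ⊗ₜ[k] h))) =
      ratAct k H A P ((convRight _ ψ * toConv x).ofConv h) (p ⊗ₜ 1) := by
  change actLift x ((ψ.lTensor P).rTensor H
    ((TensorProduct.assoc k P H H).symm (p ⊗ₜ Coalgebra.comul h))) =
      ratAct k H A P (LinearMap.mul' k _
        (TensorProduct.map (convRight _ ψ).ofConv x (Coalgebra.comul h))) (p ⊗ₜ 1)
  generalize (Coalgebra.comul (R := k) h : H ⊗[k] H) = D
  induction D with
  | zero => simp
  | add x y hx hy => simp only [map_add, TensorProduct.tmul_add, LinearMap.add_apply, hx, hy]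
  | tmul a c => simp [ratAct_mul, convRight]

theorem ratAct_convI_mul (t : H →ₗ[k] (Module.End A P)ᵐᵒᵖ) (ψ : H →ₗ[k] H) (p : P) (h : H) :
    ratAct k H A P ((convI t * convRight _ ψ).ofConv h) (p ⊗ₜ 1) =
      ψ.lTensor P (hat t (p ⊗ₜ h)) := by
  change ratAct k H A P (LinearMap.mul' k _
    (TensorProduct.map (convI t).ofConv (convRight _ ψ).ofConv (Coalgebra.comul h))) (p ⊗ₜ 1) =
      ψ.lTensor P (((evalMap t).restrictScalars k).rTensor H
        ((TensorProduct.assoc k P H H).symm (p ⊗ₜ Coalgebra.comul h)))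
  generalize (Coalgebra.comul (R := k) h : H ⊗[k] H) = D
  induction D with
  | zero => simp
  | add x y hx hy => simp only [map_add, TensorProduct.tmul_add, LinearMap.add_apply, hx, hy]
  | tmul a c => simp [convRight, convI]

/-- The hypothesis, satisfied by elements of X_j, replaces the coaction of P by a factor R_j, which
cancels the L_j of the twist; only t * R_i remains. -/
theorem actLift_convTwist [RightComodule k H P] (t : H →ₗ[k] (Module.End A P)ᵐᵒᵖ) (i j : Obj)
    (z : P ⊗[k] H) (hz : (coact k H).rTensor H z =
      ((sourceMap k H j).lTensor P).rTensor H (coact k H z)) :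
    actLift (convTwist t i j) ((coact k H).rTensor H z) =
      (sourceMap k H i).lTensor P (hat t z) := by
  rw [hz]
  clear hz
  induction z with
  | zero => simp only [map_zero]
  | add x y hx hy => simp only [map_add, hx, hy]
  | tmul p h => rw [actLift_cofree, convRight_sourceMap_mul_convTwist, ratAct_convI_mul]

/-- The two actions commute: endomorphisms are A-linear, and on the factor H one action multiplies
on the right and the other on the left. -/
theorem ratAct_diagAct (x : (Module.End A P)ᵐᵒᵖ ⊗[k] H) (y : A ⊗[k] H) (z : P ⊗[k] H) :
    ratAct k H A P x (diagAct k H A P y z) = diagAct k H A P y (ratAct k H A P x z) := by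
  induction z with
  | zero => simp
  | add a b ha hb => simp only [map_add, ha, hb]
  | tmul p g =>
    induction x with
    | zero => simp
    | add a b ha hb => simp only [map_add, LinearMap.add_apply, ha, hb]
    | tmul f h =>
      induction y with
      | zero => simp
      | add a b ha hb => simp only [map_add, LinearMap.add_apply, ha, hb]
      | tmul a c => simp [mul_assoc]

theorem actLift_smul [RightComoduleAlgebra k H A] [LeftRightHopfModule k H A P]
    (x : H →ₗ[k] (Module.End A P)ᵐᵒᵖ ⊗[k] H) (a : A) (z : P ⊗[k] H) :
    actLift x ((coact k H).rTensor H (a • z)) =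
      diagAct k H A P (coact k H a) (actLift x ((coact k H).rTensor H z)) := by
  induction z with
  | zero => simp only [smul_zero, map_zero]
  | add x y hx hy => simp only [smul_add, map_add, hx, hy]
  | tmul p h =>
    rw [TensorProduct.smul_tmul', LinearMap.rTensor_tmul, LinearMap.rTensor_tmul, actLift_tmul,
      actLift_tmul, LeftRightHopfModule.coact_smul, ratAct_diagAct]

end Evaluation

/-! ### Morphisms of the convolution category are the maps t whose `hat t` restricts. -/

section Characterization

variable {k : Type v} {H A : Type u} [CommRing k] [Ring H] [HopfAlgebra k H] [Ring A] [Algebra k A]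
  [RightComoduleAlgebra k H A] {M : Type u} [AddCommGroup M] [Module k M]
  [Module (coinvariants k H A) M] [IsScalarTower k (coinvariants k H A) M]

/-- An equation between colinear maps into a cofree comodule can be tested after applying the counit
to the last factor. Conversely, tensoring with H and precomposing with the coaction restores it. -/
theorem hat_emb_cofree_iff (t : H →ₗ[k] (Module.End A (RelTensor (coinvariants k H A) M))ᵐᵒᵖ)
    (i j : Obj) :
    (∀ x, (coact k H).rTensor H (hat t (emb k H A M j x)) =
      ((sourceMap k H i).lTensor _).rTensor H (coact k H (hat t (emb k H A M j x)))) ↔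
    ∀ x, coact k H (evalMap t (emb k H A M j x)) =
      (sourceMap k H i).lTensor _ (hat t (emb k H A M j x)) := by
  constructor
  · intro h x
    have h1 := congrArg (contract _ (Coalgebra.counit (R := k) (A := H))) (h x)
    rwa [contract_rTensor, contract_rTensor, contract_hat, contract_counit_cofree_coact] at h1
  · intro h x
    have h1 : coact k H ∘ₗ (evalMap t).restrictScalars k ∘ₗ emb k H A M j =
        (sourceMap k H i).lTensor _ ∘ₗ (hat t).restrictScalars k ∘ₗ emb k H A M j :=
      LinearMap.ext h
    have h2 := LinearMap.congr_fun (congrArg (LinearMap.rTensor H) h1) (coact k H x)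
    simp only [LinearMap.rTensor_comp, LinearMap.comp_apply, rTensor_emb_coact] at h2
    rwa [coact_hat]

/-- By the equations cutting out X_i and X_j, the left side says that ρ(t(h)(p)) = (twist of t)(h) ·
ρ(p), extended linearly in p ⊗ h, holds on the embedded X_j. Both sides transform under a ∈ A
through ρ(a), and X_j generates P ⊗ H over A, so this is equivalent to the identity on all p ⊗ h. -/
theorem hat_emb_mem_range_iff [BijectiveAntipode k H] [Module.Projective k H]
    (hGal : IsHopfGalois k H A) (hff : IsRightFaithfullyFlat (coinvariants k H A))
    (t : H →ₗ[k] (Module.End A (RelTensor (coinvariants k H A) M))ᵐᵒᵖ) (i j : Obj) :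
    (∀ x, hat t (emb k H A M j x) ∈ LinearMap.range (emb k H A M i)) ↔
      ∀ h p, coact k H ((t h).unop p) = ratAct k H A _ (convTwist t i j h) (coact k H p) := by
  simp only [mem_range_emb_iff k H A M hGal hff]
  rw [hat_emb_cofree_iff]
  have h1 : ∀ x, actLift (convTwist t i j) ((coact k H).rTensor H (emb k H A M j x)) =
      (sourceMap k H i).lTensor _ (hat t (emb k H A M j x)) := fun x =>
    actLift_convTwist t i j _ ((mem_range_emb_iff k H A M hGal hff j _).1 ⟨x, rfl⟩)
  simp only [← h1]
  constructor
  · intro h g p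
    change coact k H (evalMap t (p ⊗ₜ g)) =
      actLift (convTwist t i j) ((coact k H).rTensor H (p ⊗ₜ g))
    generalize (p ⊗ₜ[k] g) = z
    refine emb_induction hGal j (motive := fun z => coact k H (evalMap t z) =
      actLift (convTwist t i j) ((coact k H).rTensor H z)) (fun a x => ?_) (fun x y hx hy => ?_) z
    · rw [map_smul, LeftRightHopfModule.coact_smul, h, actLift_smul]
    · simp only [map_add, hx, hy]
  · intro h x
    generalize emb k H A M j x = z
    induction z with
    | zero => simp only [map_zero]
    | add x y hx hy => simp only [map_add, hx, hy]
    | tmul p g => exact h g p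

/-- The inclusion of `END_A(A ⊗_B M)^op` in `End_A(A ⊗_B M)^op`, applied to a map from `H`. -/
def toEndOp (f : H →ₗ[k] EndOpInduced k H A M) :
    H →ₗ[k] (Module.End A (RelTensor (coinvariants k H A) M))ᵐᵒᵖ :=
  (EndOpInduced k H A M).val.toLinearMap ∘ₗ f

theorem isConvHom_iff_hat_emb [BijectiveAntipode k H] [Module.Projective k H]
    (hGal : IsHopfGalois k H A) (hff : IsRightFaithfullyFlat (coinvariants k H A))
    (f : H →ₗ[k] EndOpInduced k H A M) (i j : Obj) :
    IsConvHom f i j ↔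
      ∀ x, hat (toEndOp f) (emb k H A M j x) ∈ LinearMap.range (emb k H A M i) := by
  rw [isConvHom_iff_convTwist, hat_emb_mem_range_iff hGal hff]
  refine forall_congr' fun h => ?_
  have h1 : ratIncl k H A _ (convTwist f i j h) = convTwist (toEndOp f) i j h :=
    map_convTwist (EndOpInduced k H A M).val f i j h
  rw [← h1]
  -- The coaction of f(h) is characterised by its effect on ρ(p), so an identity in E ⊗ H and its
  -- evaluation at all p are equivalent.
  refine ⟨fun h2 p => ?_, fun h2 => ratCoact_unique (f h) _ h2⟩
  rw [← h2]
  exact ratCoact_spec (f h) p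

/-- Rationality comes for free: the twist of t at h serves as f₀ ⊗ f₁ for the endomorphism t(h). -/
theorem exists_toEndOp_eq [BijectiveAntipode k H] [Module.Projective k H]
    (hGal : IsHopfGalois k H A) (hff : IsRightFaithfullyFlat (coinvariants k H A))
    (t : H →ₗ[k] (Module.End A (RelTensor (coinvariants k H A) M))ᵐᵒᵖ) (i j : Obj)
    (ht : ∀ x, hat t (emb k H A M j x) ∈ LinearMap.range (emb k H A M i)) :
    ∃ f : H →ₗ[k] EndOpInduced k H A M, toEndOp f = t := by
  rw [hat_emb_mem_range_iff hGal hff] at ht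
  exact ⟨t.codRestrict (Subalgebra.toSubmodule (EndOpInduced k H A M)) fun h => ⟨_, ht h⟩, rfl⟩

theorem toEndOp_injective : Function.Injective (toEndOp (k := k) (H := H) (A := A) (M := M)) :=
  fun _ _ h => LinearMap.ext fun x => Subtype.ext (LinearMap.congr_fun h x)

end Characterization

/-! ### Linearity and injectivity of t ↦ `hat t`. -/

section Additivity

variable {k : Type v} {H A P : Type u} [CommRing k] [Ring H] [HopfAlgebra k H] [Ring A]
  [Algebra k A] [AddCommGroup P] [Module k P] [Module A P] [IsScalarTower k A P]

theorem hat_add (s t : H →ₗ[k] (Module.End A P)ᵐᵒᵖ) (z : P ⊗[k] H) :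
    hat (s + t) z = hat s z + hat t z := by
  have h : (evalMap (s + t)).restrictScalars k =
      (evalMap s).restrictScalars k + (evalMap t).restrictScalars k :=
    TensorProduct.ext' fun _ _ => rfl
  rw [hat_apply, h, LinearMap.rTensor_add]
  rfl

theorem hat_base_smul (c : k) (t : H →ₗ[k] (Module.End A P)ᵐᵒᵖ) (z : P ⊗[k] H) :
    hat (c • t) z = c • hat t z := by
  have h : (evalMap (c • t)).restrictScalars k = c • (evalMap t).restrictScalars k :=
    TensorProduct.ext' fun _ _ => rfl
  rw [hat_apply, h, LinearMap.rTensor_smul]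
  rfl

theorem hat_injective : Function.Injective (hat (k := k) (H := H) (A := A) (P := P)) := by
  refine fun s t h => LinearMap.ext fun x => MulOpposite.unop_injective (LinearMap.ext fun p => ?_)
  rw [← evalMap_tmul, ← evalMap_tmul, ← contract_hat, ← contract_hat, h]

theorem contract_smul (φ : H →ₗ[k] k) (a : A) (z : P ⊗[k] H) :
    contract P φ (a • z) = a • contract P φ z := by
  induction z with
  | zero => simp
  | add x y hx hy => simp only [smul_add, map_add, hx, hy]
  | tmul p h => rw [TensorProduct.smul_tmul', contract_tmul, contract_tmul, smul_comm]

end Additivity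

/-! ### The bijection on morphisms. -/

section Duality

variable {k : Type v} {H A : Type u} [CommRing k] [Ring H] [HopfAlgebra k H]
  [BijectiveAntipode k H] [Module.Projective k H] [Ring A] [Algebra k A]
  [RightComoduleAlgebra k H A] {M : Type u} [AddCommGroup M] [Module k M]
  [Module (coinvariants k H A) M] [IsScalarTower k (coinvariants k H A) M]

/-- `hat` of f maps X_j into X_i, and the restriction inherits B-linearity and colinearity because
the embedding of X_i is injective. -/
theorem exists_colinear (hGal : IsHopfGalois k H A)
    (hff : IsRightFaithfullyFlat (coinvariants k H A)) {i j : Obj}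
    (f : convHom k H (EndOpInduced k H A M) i j) :
    ∃ G : BComod.colinear (objFamily k H A M j) (objFamily k H A M i),
      ∀ x, emb k H A M i (G.1 x) = hat (toEndOp f.1) (emb k H A M j x) := by
  choose g hg using (isConvHom_iff_hat_emb hGal hff f.1 i j).1 f.2
  have hinj := emb_injective M hff i
  let G : Carrier k H A M j →ₗ[coinvariants k H A] Carrier k H A M i :=
    { toFun := g
      map_add' := fun x y => hinj (by simp only [map_add, hg])
      map_smul' := fun b x => hinj (by
        rw [hg, emb_smul, map_smul, RingHom.id_apply, emb_smul, hg]) }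
  have hG : emb k H A M i ∘ₗ G.restrictScalars k =
      (hat (toEndOp f.1)).restrictScalars k ∘ₗ emb k H A M j := LinearMap.ext hg
  refine ⟨⟨G, fun x => ?_⟩, hg⟩
  -- Colinearity is checked in (P ⊗ H) ⊗ H, where X_i ⊗ H still embeds since H is flat.
  apply Module.Flat.rTensor_preserves_injective_linearMap (M := H) _ hinj
  rw [rTensor_emb_coact, ← LinearMap.rTensor_comp_apply, hG, LinearMap.rTensor_comp_apply,
    rTensor_emb_coact, ← coact_hat]
  exact congrArg _ (hg x)

/-- The composite X_j → X_i → P ⊗ H → P is B-linear, so it extends to an A-linear map on P ⊗ H, that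
is, to some t; colinearity of G then gives that `hat t` restricts to G. -/
theorem exists_convHom (hGal : IsHopfGalois k H A)
    (hff : IsRightFaithfullyFlat (coinvariants k H A)) {i j : Obj}
    (G : BComod.colinear (objFamily k H A M j) (objFamily k H A M i)) :
    ∃ f : convHom k H (EndOpInduced k H A M) i j,
      ∀ x, emb k H A M i (G.1 x) = hat (toEndOp f.1) (emb k H A M j x) := by
  have hG : ∀ x, coact k H (G.1 x) = (G.1.restrictScalars k).rTensor H (coact k H x) := G.2
  let g : Carrier k H A M j →ₗ[k] RelTensor (coinvariants k H A) M :=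
    contract _ (Coalgebra.counit (R := k) (A := H)) ∘ₗ emb k H A M i ∘ₗ G.1.restrictScalars k
  obtain ⟨F, hF⟩ := exists_extension hGal j g fun b x => by
    simp only [g, LinearMap.comp_apply, LinearMap.restrictScalars_apply]
    rw [map_smul, emb_smul, contract_smul]
  obtain ⟨t, rfl⟩ := exists_evalMap_eq F
  have hF' : (evalMap t).restrictScalars k ∘ₗ emb k H A M j = g := LinearMap.ext hF
  have ht : ∀ x, emb k H A M i (G.1 x) = hat t (emb k H A M j x) := fun x => by
    -- Colinearity of both embeddings and of G moves the coaction to the outside, where ε on the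
    -- middle factor removes it.
    rw [hat_apply, ← rTensor_emb_coact, ← LinearMap.rTensor_comp_apply, hF',
      LinearMap.rTensor_comp_apply, LinearMap.rTensor_comp_apply, ← hG, rTensor_emb_coact,
      rTensor_contract_counit]
  obtain ⟨f, rfl⟩ := exists_toEndOp_eq hGal hff t i j fun x => ⟨_, ht x⟩
  exact ⟨⟨f, (isConvHom_iff_hat_emb hGal hff f i j).2 fun x => ⟨_, ht x⟩⟩, ht⟩

/-- The colinear map `X_j → X_i` attached to a morphism `i ⟶ j` of the convolution category. -/
def convHomMap (hGal : IsHopfGalois k H A)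
    (hff : IsRightFaithfullyFlat (coinvariants k H A)) {i j : Obj}
    (f : convHom k H (EndOpInduced k H A M) i j) :
    BComod.colinear (objFamily k H A M j) (objFamily k H A M i) :=
  (exists_colinear hGal hff f).choose

theorem emb_convHomMap (hGal : IsHopfGalois k H A)
    (hff : IsRightFaithfullyFlat (coinvariants k H A)) {i j : Obj}
    (f : convHom k H (EndOpInduced k H A M) i j) (x : Carrier k H A M j) :
    emb k H A M i ((convHomMap hGal hff f).1 x) = hat (toEndOp f.1) (emb k H A M j x) :=
  (exists_colinear hGal hff f).choose_spec x

/-- The embedding of X_i is injective, so functoriality and linearity reduce to identities for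
`hat`. -/
theorem convHomMap_eq (hGal : IsHopfGalois k H A)
    (hff : IsRightFaithfullyFlat (coinvariants k H A)) {i j : Obj}
    {f : convHom k H (EndOpInduced k H A M) i j}
    {G : BComod.colinear (objFamily k H A M j) (objFamily k H A M i)}
    (h : ∀ x, hat (toEndOp f.1) (emb k H A M j x) = emb k H A M i (G.1 x)) :
    convHomMap hGal hff f = G :=
  Subtype.ext <| LinearMap.ext fun x =>
    emb_injective M hff i <| (emb_convHomMap hGal hff f x).trans (h x)

/-- `hat` is A-linear and X_j generates P ⊗ H, so `hat` of f is determined by its restriction to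
X_j, and it determines f. -/
theorem convHomMap_injective (hGal : IsHopfGalois k H A)
    (hff : IsRightFaithfullyFlat (coinvariants k H A)) {i j : Obj} :
    Function.Injective (convHomMap hGal hff (M := M) (i := i) (j := j)) := by
  intro f f' h
  have h1 : hat (toEndOp f.1) = hat (toEndOp f'.1) := LinearMap.ext fun z => by
    refine emb_induction hGal j (motive := fun z => hat (toEndOp f.1) z = hat (toEndOp f'.1) z)
      (fun a x => ?_) (fun x y hx hy => ?_) z
    · rw [map_smul, map_smul, ← emb_convHomMap hGal hff, ← emb_convHomMap hGal hff, h]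
    · rw [map_add, map_add, hx, hy]
  exact Subtype.ext (toEndOp_injective (hat_injective h1))

theorem convHomMap_surjective (hGal : IsHopfGalois k H A)
    (hff : IsRightFaithfullyFlat (coinvariants k H A)) {i j : Obj} :
    Function.Surjective (convHomMap hGal hff (M := M) (i := i) (j := j)) := by
  intro G
  obtain ⟨f, hf⟩ := exists_convHom hGal hff G
  exact ⟨f, convHomMap_eq hGal hff fun x => (hf x).symm⟩

theorem convHomMap_add (hGal : IsHopfGalois k H A)
    (hff : IsRightFaithfullyFlat (coinvariants k H A)) {i j : Obj}
    (f f' : convHom k H (EndOpInduced k H A M) i j) :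
    convHomMap hGal hff (f + f') = convHomMap hGal hff f + convHomMap hGal hff f' := by
  refine convHomMap_eq hGal hff fun x => ?_
  have h : toEndOp (f + f').1 = toEndOp f.1 + toEndOp f'.1 := rfl
  rw [h, hat_add, ← emb_convHomMap hGal hff, ← emb_convHomMap hGal hff, ← map_add]
  rfl

theorem convHomMap_smul (hGal : IsHopfGalois k H A)
    (hff : IsRightFaithfullyFlat (coinvariants k H A)) {i j : Obj} (c : k)
    (f : convHom k H (EndOpInduced k H A M) i j) :
    convHomMap hGal hff (c • f) = c • convHomMap hGal hff f := by
  refine convHomMap_eq hGal hff fun x => ?_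
  have h : toEndOp (c • f).1 = c • toEndOp f.1 := rfl
  rw [h, hat_base_smul, ← emb_convHomMap hGal hff, ← map_smul]
  rfl

end Duality

/-! ### Identities and composites. -/

section Functors

variable {k : Type v} {H A : Type u} [CommRing k] [Ring H] [HopfAlgebra k H]
  [BijectiveAntipode k H] [Module.Projective k H] [Ring A] [Algebra k A]
  [RightComoduleAlgebra k H A] {M : Type u} [AddCommGroup M] [Module k M]
  [Module (coinvariants k H A) M] [IsScalarTower k (coinvariants k H A) M]

theorem toEndOp_counit : toEndOp (k := k) (H := H) (A := A) (M := M)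
    (Algebra.linearMap k _ ∘ₗ Coalgebra.counit) = Algebra.linearMap k _ ∘ₗ Coalgebra.counit :=
  LinearMap.ext fun _ => rfl

theorem toEndOp_conv (g f : H →ₗ[k] EndOpInduced k H A M) :
    toEndOp (conv g f) = conv (toEndOp g) (toEndOp f) :=
  LinearMap.algHom_comp_convMul_distrib (EndOpInduced k H A M).val (toConv g) (toConv f)

theorem hat_toEndOp_counit (z : RelTensor (coinvariants k H A) M ⊗[k] H) :
    hat (toEndOp (k := k) (H := H) (A := A) (M := M)
      (Algebra.linearMap k _ ∘ₗ Coalgebra.counit)) z = z := by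
  rw [toEndOp_counit, hat_counit]

theorem hat_toEndOp_conv (g f : H →ₗ[k] EndOpInduced k H A M)
    (z : RelTensor (coinvariants k H A) M ⊗[k] H) :
    hat (toEndOp (conv g f)) z = hat (toEndOp f) (hat (toEndOp g) z) := by
  rw [toEndOp_conv, hat_conv]

open CategoryTheory Opposite

/-- The morphism of `_B M^H` attached to a morphism of the convolution category. -/
def convMap (hGal : IsHopfGalois k H A) (hff : IsRightFaithfullyFlat (coinvariants k H A))
    {i j : Obj} (f : convHom k H (EndOpInduced k H A M) i j) :
    objFamily k H A M j ⟶ objFamily k H A M i :=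
  convHomMap hGal hff f

theorem convMap_id (hGal : IsHopfGalois k H A)
    (hff : IsRightFaithfullyFlat (coinvariants k H A)) (i : Obj) :
    convMap hGal hff (⟨_, isConvHom_id i⟩ : convHom k H (EndOpInduced k H A M) i i) =
      𝟙 (objFamily k H A M i) :=
  convHomMap_eq hGal hff fun x => hat_toEndOp_counit (emb k H A M i x)

theorem convMap_conv (hGal : IsHopfGalois k H A)
    (hff : IsRightFaithfullyFlat (coinvariants k H A)) {i j l : Obj}
    (f : convHom k H (EndOpInduced k H A M) i j) (g : convHom k H (EndOpInduced k H A M) j l) :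
    convMap hGal hff (⟨conv g.1 f.1, IsConvHom.conv g.2 f.2⟩ :
      convHom k H (EndOpInduced k H A M) i l) = convMap hGal hff g ≫ convMap hGal hff f := by
  refine convHomMap_eq hGal hff fun x => ?_
  rw [hat_toEndOp_conv, ← emb_convHomMap hGal hff, ← emb_convHomMap hGal hff]
  rfl

end Functors

/-! ### The contravariant functor and its strict inverse. -/

section Duality

open CategoryTheory Opposite

variable {k : Type v} {H A : Type u} [CommRing k] [Ring H] [HopfAlgebra k H]
  [BijectiveAntipode k H] [Module.Projective k H] [Ring A] [Algebra k A]
  [RightComoduleAlgebra k H A] {M : Type u} [AddCommGroup M] [Module k M]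
  [Module (coinvariants k H A) M] [IsScalarTower k (coinvariants k H A) M]

/-- The contravariant functor from the convolution category of `END_A(A ⊗_B M)^op` to the full
subcategory of `_B M^H` on `M ⊗ H` and `A ⊗_B M`. -/
def convFunctor (hGal : IsHopfGalois k H A)
    (hff : IsRightFaithfullyFlat (coinvariants k H A)) :
    (ConvCat k H (EndOpInduced k H A M))ᵒᵖ ⥤ TwoObjSubcat k H A M where
  obj X := (X.unop : Obj)
  map f := ⟨convMap hGal hff f.unop⟩
  map_id X := InducedCategory.hom_ext (convMap_id hGal hff X.unop)
  map_comp f g := InducedCategory.hom_ext (convMap_conv hGal hff g.unop f.unop)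

theorem convFunctor_map_bijective (hGal : IsHopfGalois k H A)
    (hff : IsRightFaithfullyFlat (coinvariants k H A))
    (X Y : (ConvCat k H (EndOpInduced k H A M))ᵒᵖ) :
    Function.Bijective ((convFunctor hGal hff).map (X := X) (Y := Y)) :=
  ⟨fun _ _ h => Quiver.Hom.unop_inj (convHomMap_injective hGal hff
      (congrArg InducedCategory.Hom.hom h)),
    fun G => by
      obtain ⟨f, hf⟩ := convHomMap_surjective hGal hff (M := M) (i := Y.unop) (j := X.unop) G.hom
      exact ⟨Quiver.Hom.op (X := Y.unop) (Y := X.unop) f, InducedCategory.hom_ext hf⟩⟩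

/-- The bijection induced by `convFunctor` on morphisms. -/
def convFunctorEquiv (hGal : IsHopfGalois k H A)
    (hff : IsRightFaithfullyFlat (coinvariants k H A))
    (X Y : (ConvCat k H (EndOpInduced k H A M))ᵒᵖ) :
    (X ⟶ Y) ≃ ((convFunctor hGal hff).obj X ⟶ (convFunctor hGal hff).obj Y) :=
  Equiv.ofBijective _ (convFunctor_map_bijective hGal hff X Y)

theorem map_convFunctorEquiv_symm (hGal : IsHopfGalois k H A)
    (hff : IsRightFaithfullyFlat (coinvariants k H A))
    {X Y : (ConvCat k H (EndOpInduced k H A M))ᵒᵖ}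
    (G : (convFunctor hGal hff).obj X ⟶ (convFunctor hGal hff).obj Y) :
    (convFunctor hGal hff).map ((convFunctorEquiv hGal hff X Y).symm G) = G :=
  (convFunctorEquiv hGal hff X Y).apply_symm_apply G

/-- The object of `ConvCatᵒᵖ` with a given label. -/
def labelOp (i : TwoObjSubcat k H A M) : (ConvCat k H (EndOpInduced k H A M))ᵒᵖ := op (i : Obj)

/-- The inverse of `convFunctor`. -/
def convFunctorInv (hGal : IsHopfGalois k H A)
    (hff : IsRightFaithfullyFlat (coinvariants k H A)) :
    TwoObjSubcat k H A M ⥤ (ConvCat k H (EndOpInduced k H A M))ᵒᵖ where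
  obj i := labelOp i
  map {i j} G := (convFunctorEquiv hGal hff (labelOp i) (labelOp j)).symm G
  -- The functor is the identity on labels and bijective on morphisms, so the laws for the inverse
  -- follow from its own laws by injectivity.
  map_id i := (convFunctor_map_bijective hGal hff (labelOp i) (labelOp i)).1
    ((map_convFunctorEquiv_symm hGal hff (X := labelOp i) (Y := labelOp i) (𝟙 i)).trans
      ((convFunctor hGal hff (M := M)).map_id (labelOp i)).symm)
  map_comp {i j l} G G' := (convFunctor_map_bijective hGal hff (labelOp i) (labelOp l)).1
    ((map_convFunctorEquiv_symm hGal hff (X := labelOp i) (Y := labelOp l) (G ≫ G')).trans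
      (((convFunctor hGal hff (M := M)).map_comp (X := labelOp i) (Y := labelOp j)
        (Z := labelOp l) _ _).trans (congrArg₂ (CategoryStruct.comp (X := i) (Y := j) (Z := l))
          (map_convFunctorEquiv_symm hGal hff (X := labelOp i) (Y := labelOp j) G)
          (map_convFunctorEquiv_symm hGal hff (X := labelOp j) (Y := labelOp l) G'))).symm)

/-- The duality between the convolution category of `END_A(A ⊗_B M)^op` and the full subcategory
of `_B M^H` on `M ⊗ H` and `A ⊗_B M`. -/
def convDuality (hGal : IsHopfGalois k H A)
    (hff : IsRightFaithfullyFlat (coinvariants k H A)) :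
    LinearDuality k (ConvCat k H (EndOpInduced k H A M)) (TwoObjSubcat k H A M) where
  functor := convFunctor hGal hff
  inverse := convFunctorInv hGal hff
  -- Labels agree definitionally, so the heterogeneous equality of morphisms is an ordinary one.
  functor_comp_inverse := CategoryTheory.Functor.hext (fun _ => rfl) fun X Y f =>
    heq_of_eq ((convFunctorEquiv hGal hff X Y).symm_apply_apply f)
  inverse_comp_functor := CategoryTheory.Functor.hext (fun _ => rfl) fun i j G =>
    heq_of_eq (map_convFunctorEquiv_symm hGal hff (X := labelOp i) (Y := labelOp j) G)
  map_add f g := InducedCategory.hom_ext (convHomMap_add hGal hff f g)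
  map_smul c f := InducedCategory.hom_ext (convHomMap_smul hGal hff c f)

end Duality

end HopfGalois

end

theorem theorem4p1 {k : Type v} {H A M : Type u} [CommRing k]
    [Ring H] [HopfAlgebra k H] [HopfGalois.BijectiveAntipode k H] [Module.Projective k H]
    [Ring A] [Algebra k A] [HopfGalois.RightComoduleAlgebra k H A]
    (hGal : HopfGalois.IsHopfGalois k H A)
    (hff : HopfGalois.IsRightFaithfullyFlat (HopfGalois.coinvariants k H A))
    [AddCommGroup M] [Module k M] [Module (HopfGalois.coinvariants k H A) M]
    [IsScalarTower k (HopfGalois.coinvariants k H A) M] :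
    ∃ α : HopfGalois.LinearDuality k
        (HopfGalois.ConvCat k H (HopfGalois.EndOpInduced k H A M))
        (HopfGalois.TwoObjSubcat k H A M),
      α.functor.obj (Opposite.op HopfGalois.Obj.one) = HopfGalois.Obj.one ∧
      α.functor.obj (Opposite.op HopfGalois.Obj.two) = HopfGalois.Obj.two :=
  ⟨HopfGalois.convDuality hGal hff, rfl, rfl⟩
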